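/- Let $d\ge 1$, $\theta\in\mathbb R$, let $\mathcal H=\{z\in\mathbb C:\theta-\frac{\pi}{2}<\arg z<\theta+\frac{\pi}{2}\}$ and let $\log$ be the branch of the logarithm on $\mathcal H$ with imaginary part in $(\theta-\frac\pi2,\theta+\frac\pi2)$; complex powers of elements of $\mathcal H$ are taken with this branch. Let $\boldsymbol w=(w_1,\dots,w_d)\in\mathcal H^d$ and $\boldsymbol n\cdot\boldsymbol w=\sum_i n_iw_i$. **Notation.** For $a\in\mathcal H$ let $\zeta_{\rm B}(\alpha,a|\boldsymbol w)=\sum_{\boldsymbol n\in\mathbb N_0^d}(a+\boldsymbol n\cdot\boldsymbol w)^{-\alpha}$ be the Barnes zeta function and $\zeta_{\rm Bh}(\alpha|\boldsymbol w)=\sum_{\boldsymbol n\in\mathbb N_0^d\setminus\{\boldsymbol 0\}}(\boldsymbol n\cdot\boldsymbol w)^{-\alpha}$ the homogeneous Barnes zeta function ($\Re\alpha>d$), both continued analytically in $\alpha$ to $\mathbb C\setminus\{1,\dots,d\}$. Primes denote $\partial/\partial\alpha$. $F.P.$ and $Res$ denote the constant Laurent coefficient and the residue. Put $H_k=\sum_{i=1}^k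 1/i$ and $\mathcal C_{M-1}=\{0,\dots,M-1\}^d$. For a function $f$ put $$F[f(x)]_{x=\boldsymbol w}=\sum_{\emptyset\ne S\subseteq\{1,\dots,d\}}(-1)^{d-|S|}f\Big(\sum_{i\in S}w_i\Big),\qquad G[f(x)]_{x=\boldsymbol w}=(-1)^df(0)+F[f(x)]_{x=\boldsymbol w}.$$ The polynomials $B_n(a|\boldsymbol w)$ are given by $z^de^{az}\prod_{i=1}^d\frac{w_i}{e^{w_iz}-1}=\sum_{n\ge0}B_n(a|\boldsymbol w)\frac{z^n}{n!}$, and ${}_dS_n(a)$ by ${}_dS_n(0)=0$ and ${}_dS_n'(a)=\frac{n!}{(n+d-1)!\prod_iw_i}B_{n+d-1}(a|\boldsymbol w)$ (derivative in $a$). Write $s_m={}_dS_m^{(d)}(0)$ for the $d$-th derivative at $0$. Finally, with $a\to0$ inside $\mathcal H$, $$\log\rho_{\rm B}(\boldsymbol w)=-\lim_{a\to0}\big[\zeta_{\rm B}'(0,a|\boldsymbol w)+\log a\big],\quad \log\Gamma_{\rm B}(a|\boldsymbol w)=\zeta_{\rm B}'(0,a|\boldsymbol w)+\log\rho_{\rm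 B}(\boldsymbol w),$$ $$\Psi_{\rm B}^{(q)}(a|\boldsymbol w)=\frac{d^q}{da^q}\log\Gamma_{\rm B}(a|\boldsymbol w),\quad \gamma_{dq}(\boldsymbol w)=\lim_{a\to0}\Big[\frac{(-1)^q(q-1)!}{a^q}-\Psi_{\rm B}^{(q)}(a|\boldsymbol w)\Big].$$ **Statement.** The analytic continuations exist, $\log\Gamma_{\rm B}(a|\boldsymbol w)$ is analytic in $a\in\mathcal H$, $\zeta_{\rm Bh}$ has at most simple poles at $1,\dots,d$, the limits defining $\log\rho_{\rm B}$ and $\gamma_{dq}$ ($1\le q\le d$) exist, the series over $\boldsymbol n$ below converge absolutely, and the following hold. (1) For $q=1,\dots,d$, $$F.P.[\zeta_{\rm Bh}(\alpha|\boldsymbol w)]_{\alpha=q}=\frac{(-1)^q}{(q-1)!}\sum_{m=0}^{d-q}\frac{s_m}{m!(d-q-m)!}F[x^{d-q-m}\log x]_{x=\boldsymbol w}+\frac{s_{d-q}(-1)^{d+q+1}}{(q-1)!(d-q)!}H_{q-1}$$ $$+\sum_{\boldsymbol n\in\mathbb N_0^d\setminus\{\boldsymbol0\}}\Big[\frac1{(\boldsymbol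 n\cdot\boldsymbol w)^q}+\frac{(-1)^q}{(q-1)!}\sum_{m=0}^{d-q}\frac{s_m}{m!(d-q-m)!}G[(\boldsymbol n\cdot\boldsymbol w+x)^{d-q-m}\log(\boldsymbol n\cdot\boldsymbol w+x)]_{x=\boldsymbol w}\Big].$$ (2) For $q=1,\dots,d$, $$F.P.[\zeta_{\rm Bh}(\alpha|\boldsymbol w)]_{\alpha=q}=\lim_{M\to\infty}\Big[\frac{(-1)^q}{(q-1)!}\sum_{m=0}^{d-q}\frac{s_m}{m!(d-q-m)!}F[x^{d-q-m}\log x]_{x=\boldsymbol w}M^{d-q-m}$$ $$+\frac{s_{d-q}(-1)^{d+q+1}}{(q-1)!(d-q)!}\log M+\sum_{\boldsymbol n\in\mathcal C_{M-1}\setminus\{\boldsymbol0\}}(\boldsymbol n\cdot\boldsymbol w)^{-q}\Big]+\frac{s_{d-q}(-1)^{d+q+1}}{(q-1)!(d-q)!}H_{q-1}.$$ (3) $$\zeta_{\rm Bh}'(0|\boldsymbol w)=\sum_{\boldsymbol n\in\mathbb N_0^d\setminus\{\boldsymbol0\}}\Big[-\log(\boldsymbol n\cdot\boldsymbol w)-H_d+\sum_{m=0}^d\frac{s_m}{m!(d-m)!}G[(\boldsymbol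 n\cdot\boldsymbol w+x)^{d-m}\log(\boldsymbol n\cdot\boldsymbol w+x)]_{x=\boldsymbol w}\Big]$$ $$+\sum_{m=0}^d\frac{s_m}{m!(d-m)!}F[x^{d-m}\log x]_{x=\boldsymbol w}-H_d.$$ (4) $$\zeta_{\rm Bh}'(0|\boldsymbol w)=\lim_{M\to\infty}\Big[M^d(\log M-H_d)+\sum_{m=0}^d\frac{s_m}{m!(d-m)!}F[x^{d-m}\log x]_{x=\boldsymbol w}M^{d-m}$$ $$+(-1)^{d-1}\frac{s_d}{d!}\log M-\sum_{\boldsymbol n\in\mathcal C_{M-1}\setminus\{\boldsymbol0\}}\log(\boldsymbol n\cdot\boldsymbol w)\Big].$$ (5) $\zeta_{\rm Bh}'(0|\boldsymbol w)=-\log\rho_{\rm B}(\boldsymbol w)$, and for $q=1,\dots,d$ $$F.P.[\zeta_{\rm Bh}(\alpha|\boldsymbol w)]_{\alpha=q}=\frac{(-1)^{q-1}}{(q-1)!}\gamma_{dq}(\boldsymbol w)-H_{q-1}\,Res[\zeta_{\rm Bh}(\alpha|\boldsymbol w)]_{\alpha=q}.$$ -/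

import Mathlib

open Filter Topology Polynomial
open scoped Nat

namespace BarnesH

noncomputable section

/-- The open half-plane `{z : θ - π/2 < arg z < θ + π/2}`, that is `Re (z e^{-iθ}) > 0`. -/
def halfPlane (θ : ℝ) : Set ℂ :=
  {z | 0 < (z * Complex.exp (-(θ * Complex.I))).re}

/-- The branch of the logarithm on `halfPlane θ` whose imaginary part lies in
`(θ - π/2, θ + π/2)`. Every continuous branch on that half-plane is obtained by adding a multiple
of `2π` to `θ`. -/
def branchLog (θ : ℝ) (z : ℂ) : ℂ :=
  Complex.log (z * Complex.exp (-(θ * Complex.I))) + θ * Complex.I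

/-- `z ^ s` for that branch of the logarithm. -/
def branchPow (θ : ℝ) (z s : ℂ) : ℂ :=
  Complex.exp (s * branchLog θ z)

/-- `n · w = ∑ i, n_i w_i`. -/
def dotW {d : ℕ} (n : Fin d → ℕ) (w : Fin d → ℂ) : ℂ :=
  ∑ i, (n i : ℂ) * w i

/-- `Z` is the analytic continuation to `ℂ \ {1, …, d}` of the Barnes zeta function
`∑_{n ∈ ℕ₀^d} (a + n · w)^{-α}`, `Re α > d` (the values of `Z` at `1, …, d` are irrelevant). -/
def IsBarnesZeta {d : ℕ} (θ : ℝ) (w : Fin d → ℂ) (a : ℂ) (Z : ℂ → ℂ) : Prop :=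
  DifferentiableOn ℂ Z {α | ∀ j ∈ Finset.Icc 1 d, α ≠ (j : ℂ)} ∧
    ∀ α : ℂ, (d : ℝ) < α.re →
      HasSum (fun n : Fin d → ℕ => branchPow θ (a + dotW n w) (-α)) (Z α)

/-- `Z` is the analytic continuation to `ℂ \ {1, …, d}` of the homogeneous Barnes zeta function
`∑_{n ∈ ℕ₀^d \ {0}} (n · w)^{-α}`, `Re α > d`. -/
def IsHomBarnesZeta {d : ℕ} (θ : ℝ) (w : Fin d → ℂ) (Z : ℂ → ℂ) : Prop :=
  DifferentiableOn ℂ Z {α | ∀ j ∈ Finset.Icc 1 d, α ≠ (j : ℂ)} ∧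
    ∀ α : ℂ, (d : ℝ) < α.re →
      HasSum (fun n : {n : Fin d → ℕ // n ≠ 0} => branchPow θ (dotW n.1 w) (-α)) (Z α)

open Classical in
/-- The Barnes zeta function `α ↦ ζ_B(α, a | w)`, continued analytically. -/
def barnesZeta {d : ℕ} (θ : ℝ) (w : Fin d → ℂ) (a : ℂ) : ℂ → ℂ :=
  if h : ∃ Z, IsBarnesZeta θ w a Z then h.choose else 0

open Classical in
/-- The homogeneous Barnes zeta function `α ↦ ζ_Bh(α | w)`, continued analytically. -/
def homBarnesZeta {d : ℕ} (θ : ℝ) (w : Fin d → ℂ) : ℂ → ℂ :=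
  if h : ∃ Z, IsHomBarnesZeta θ w Z then h.choose else 0

/-- Residue of `Z` at a point `p` where `Z` has at most a simple pole. -/
def residue (Z : ℂ → ℂ) (p : ℂ) : ℂ :=
  limUnder (𝓝[≠] p) fun α => (α - p) * Z α

/-- Finite part (constant Laurent coefficient) of `Z` at a point `p` where `Z` has at most a
simple pole. -/
def finitePart (Z : ℂ → ℂ) (p : ℂ) : ℂ :=
  limUnder (𝓝[≠] p) fun α => Z α - residue Z p / (α - p)

/-- The generating function `e^{az} ∏ i, w_i z / (e^{w_i z} - 1)`, as a formal power series in `z`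
with coefficients polynomial in the variable `a`. -/
def bernoulliGen {d : ℕ} (w : Fin d → ℂ) : PowerSeries ℂ[X] :=
  PowerSeries.rescale X (PowerSeries.exp ℂ[X]) *
    ∏ i, PowerSeries.rescale (C (w i)) (bernoulliPowerSeries ℂ[X])

theorem bernoulliGen_mul {d : ℕ} (w : Fin d → ℂ) :
    bernoulliGen w * ∏ i, (PowerSeries.rescale (C (w i)) (PowerSeries.exp ℂ[X]) - 1) =
      PowerSeries.X ^ d * PowerSeries.rescale X (PowerSeries.exp ℂ[X]) *
        ∏ i, PowerSeries.C (C (w i)) := by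
  have h : ∀ i, PowerSeries.rescale (C (w i)) (bernoulliPowerSeries ℂ[X]) *
      (PowerSeries.rescale (C (w i)) (PowerSeries.exp ℂ[X]) - 1) =
      PowerSeries.X * PowerSeries.C (C (w i)) := by
    intro i
    have := congrArg (PowerSeries.rescale (C (w i))) (bernoulliPowerSeries_mul_exp_sub_one ℂ[X])
    rw [map_mul, map_sub, map_one, PowerSeries.rescale_X] at this
    rw [this, mul_comm]
  rw [bernoulliGen, mul_assoc, ← Finset.prod_mul_distrib, Finset.prod_congr rfl fun i _ => h i,
    Finset.prod_mul_distrib, Finset.prod_const, Finset.card_univ, Fintype.card_fin]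
  ring

/-- The higher order Bernoulli polynomial `B_n(a | w)`, in the variable `a`:
`z^d e^{az} ∏ i, w_i / (e^{w_i z} - 1) = ∑ n, B_n(a | w) z^n / n!`. -/
def bernoulliPoly {d : ℕ} (w : Fin d → ℂ) (n : ℕ) : ℂ[X] :=
  n ! • PowerSeries.coeff n (bernoulliGen w)

/-- The primitive of a polynomial that vanishes at `0`. -/
def primitive (p : ℂ[X]) : ℂ[X] :=
  p.sum fun k c => monomial (k + 1) (c / (k + 1))

theorem derivative_primitive (p : ℂ[X]) : derivative (primitive p) = p := by
  have h : ∀ k : ℕ, (k : ℂ) + 1 ≠ 0 := fun k => by exact_mod_cast Nat.succ_ne_zero k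
  rw [primitive, Polynomial.sum, derivative_sum]
  conv_rhs => rw [p.as_sum_support]
  refine Finset.sum_congr rfl fun k _ => ?_
  rw [derivative_monomial]
  simp [div_mul_cancel₀ _ (h k)]

theorem eval_zero_primitive (p : ℂ[X]) : (primitive p).eval 0 = 0 := by
  rw [primitive, Polynomial.sum, eval_finsetSum]
  simp

/-- Barnes' Bernoullian function `_dS_n(a)`: `_dS_n(0) = 0` and
`_dS_n'(a) = n! / ((n + d - 1)! ∏ w_i) * B_{n+d-1}(a | w)` (for `d ≥ 1`). -/
def bernoullian {d : ℕ} (w : Fin d → ℂ) (n : ℕ) : ℂ[X] :=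
  primitive (C ((n ! : ℂ) / ((n + d - 1)! * ∏ i, w i)) * bernoulliPoly w (n + d - 1))

/-- `_dS_m^{(d)}(0)`. -/
def coeffS {d : ℕ} (w : Fin d → ℂ) (m : ℕ) : ℂ :=
  (derivative^[d] (bernoullian w m)).eval 0

/-- `F[f(x)]_{x = w} = ∑_{∅ ≠ S ⊆ {1,…,d}} (-1)^{d - |S|} f(∑_{i ∈ S} w_i)`. -/
def opF {d : ℕ} (w : Fin d → ℂ) (f : ℂ → ℂ) : ℂ :=
  ∑ S : Finset (Fin d) with S.Nonempty, (-1 : ℂ) ^ (d - S.card) * f (∑ i ∈ S, w i)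

/-- `G[f(x)]_{x = w} = (-1)^d f(0) + F[f(x)]_{x = w}`. -/
def opG {d : ℕ} (w : Fin d → ℂ) (f : ℂ → ℂ) : ℂ :=
  (-1 : ℂ) ^ d * f 0 + opF w f

/-- The cube `C_{M-1} = {0, …, M-1}^d` without the origin. -/
def puncturedCube (d M : ℕ) : Finset (Fin d → ℕ) :=
  (Fintype.piFinset fun _ => Finset.range M).erase 0

/-- `H_k = 1 + 1/2 + ⋯ + 1/k`, as a complex number. -/
def harm (k : ℕ) : ℂ := ((harmonic k : ℚ) : ℂ)

/-- `log ρ_B(w) = - lim_{a → 0} (ζ_B'(0, a | w) + log a)`, `a` in the half-plane. -/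
def logRho {d : ℕ} (θ : ℝ) (w : Fin d → ℂ) : ℂ :=
  -limUnder (𝓝[halfPlane θ] 0) fun a => deriv (barnesZeta θ w a) 0 + branchLog θ a

/-- `log Γ_B(a | w)`, given by `log (Γ_B(a | w) / ρ_B(w)) = ζ_B'(0, a | w)`. -/
def logGammaB {d : ℕ} (θ : ℝ) (w : Fin d → ℂ) (a : ℂ) : ℂ :=
  deriv (barnesZeta θ w a) 0 + logRho θ w

/-- `Ψ_B^{(n)}(a | w) = (d/da)^n log Γ_B(a | w)`. -/
def psiB {d : ℕ} (θ : ℝ) (w : Fin d → ℂ) (n : ℕ) (a : ℂ) : ℂ :=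
  iteratedDeriv n (logGammaB θ w) a

/-- The function whose limit at `a → 0` is the gamma modular form `γ_{dq}(w)`. -/
def gammaModularAux {d : ℕ} (θ : ℝ) (w : Fin d → ℂ) (q : ℕ) (a : ℂ) : ℂ :=
  (-1 : ℂ) ^ q * ((q - 1)! : ℂ) / a ^ q - psiB θ w q a

/-- The `q`-th gamma modular form
`γ_{dq}(w) = lim_{a → 0} ((-1)^q (q-1)! / a^q - Ψ_B^{(q)}(a | w))`, `a` in the half-plane. -/
def gammaModular {d : ℕ} (θ : ℝ) (w : Fin d → ℂ) (q : ℕ) : ℂ :=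
  limUnder (𝓝[halfPlane θ] 0) (gammaModularAux θ w q)

end

end BarnesH

namespace BarnesH

/-! The proof is a multidimensional Euler–Maclaurin summation. With T_v the translation by v, G is
the operator ∏ (T_{w_i} − 1) evaluated at 0, and t_m = s_m/m! (`toddCoeff`) are the Taylor
coefficients of ∏ z/(e^{w_i z} − 1). If f_0, f_1, … are successive derivatives, then formally f_d =
∏ (T_{w_i} − 1) ∑_m t_m f_m. Truncation at m ≤ N leaves an error `regTerm` controlled by f_{d+N+1}
(`exists_norm_regTerm_le`), hence summable over the lattice cone for large N, while the differences
telescope over cubes into boundary terms (`sum_puncturedCube_opG`). The resulting `regSum` is a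
regularised value of ∑ f_d(a + n·w).

For f_0 = z^(d−α)/((1−α)⋯(d−α)), where f_d = z^(−α), this is the analytic continuation in α.
Differentiation in α at 0 replaces `zetaTower` by `logTower`, where f_d = −log z; this yields
ζ_Bh'(0) and, with apex a, log Γ_B.

As α → q the coefficients blow up, but the singular parts are polynomials in z of degree below d.
They are annihilated by G in every term of the series and survive only in the finite boundary sum,
since F omits the empty subset. This gives the residue; what is left is `logTower` shifted by q,
plus a multiple of H_{q−1} (`tendsto_homBarnesZeta_sub`). Differentiating log Γ_B q times in a
shifts `logTower` by q as well, so the finite part at q and γ_{dq} involve the same regularised sum.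
-/

/-! ### Difference operators and telescoping over cubes -/

theorem opG_eq_sum {d : ℕ} (w : Fin d → ℂ) (f : ℂ → ℂ) :
    opG w f = ∑ S : Finset (Fin d), (-1 : ℂ) ^ (d - S.card) * f (∑ i ∈ S, w i) := by
  rw [← Finset.sum_filter_add_sum_filter_not Finset.univ (fun S : Finset (Fin d) => S.Nonempty),
    add_comm, opG, opF]
  congr 1
  rw [Finset.sum_eq_single ∅] <;> simp +contextual

theorem opF_eq_sub {d : ℕ} (w : Fin d → ℂ) (f : ℂ → ℂ) :
    opF w f = opG w f - (-1 : ℂ) ^ d * f 0 := by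
  rw [opG]; ring

theorem opG_sum {d : ℕ} (w : Fin d → ℂ) {ι : Type*} (s : Finset ι) (f : ι → ℂ → ℂ) :
    opG w (fun x => ∑ k ∈ s, f k x) = ∑ k ∈ s, opG w (f k) := by
  simp only [opG_eq_sum, Finset.mul_sum]
  exact Finset.sum_comm

theorem opG_const_mul {d : ℕ} (w : Fin d → ℂ) (c : ℂ) (f : ℂ → ℂ) :
    opG w (fun x => c * f x) = c * opG w f := by
  simp only [opG_eq_sum, Finset.mul_sum]
  exact Finset.sum_congr rfl fun S _ => by ring

theorem opG_sub {d : ℕ} (w : Fin d → ℂ) (f g : ℂ → ℂ) :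
    opG w (fun x => f x - g x) = opG w f - opG w g := by
  simp only [opG_eq_sum, ← Finset.sum_sub_distrib, mul_sub]

theorem opF_const_mul {d : ℕ} (w : Fin d → ℂ) (c : ℂ) (f : ℂ → ℂ) :
    opF w (fun x => c * f x) = c * opF w f := by
  simp only [opF, Finset.mul_sum]
  exact Finset.sum_congr rfl fun S _ => by ring

theorem opF_sub {d : ℕ} (w : Fin d → ℂ) (f g : ℂ → ℂ) :
    opF w (fun x => f x - g x) = opF w f - opF w g := by
  simp only [opF, ← Finset.sum_sub_distrib, mul_sub]

theorem prod_sub_one_eq_sum {R : Type*} [CommRing R] {d : ℕ} (t : Fin d → R) :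
    ∏ i, (t i - 1) = ∑ S : Finset (Fin d), (-1) ^ (d - S.card) * ∏ i ∈ S, t i := by
  simp only [sub_eq_add_neg]
  rw [Finset.prod_add, Finset.powerset_univ]
  refine Finset.sum_congr rfl fun S _ => ?_
  rw [Finset.prod_const, ← Finset.compl_eq_univ_sdiff, Finset.card_compl, Fintype.card_fin,
    mul_comm]

/-- The linear functional on formal combinations of translations that evaluates them at `f`. -/
noncomputable def translationEval (f : ℂ → ℂ) : AddMonoidAlgebra ℂ ℂ →ₗ[ℂ] ℂ :=
  (Finsupp.lsum ℂ fun z => LinearMap.toSpanSingleton ℂ ℂ (f z)) ∘ₗ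
    (AddMonoidAlgebra.coeffLinearEquiv ℂ).toLinearMap

theorem translationEval_single (f : ℂ → ℂ) (z c : ℂ) :
    translationEval f (AddMonoidAlgebra.single z c) = c * f z := by
  simp [translationEval]

theorem single_sum_one {ι : Type*} (s : Finset ι) (v : ι → ℂ) :
    (AddMonoidAlgebra.single (∑ i ∈ s, v i) 1 : AddMonoidAlgebra ℂ ℂ) =
      ∏ i ∈ s, AddMonoidAlgebra.single (v i) 1 := by
  classical
  induction s using Finset.induction_on with
  | empty => simp [AddMonoidAlgebra.one_def]
  | insert a s ha ih =>
    rw [Finset.sum_insert ha, Finset.prod_insert ha, ← ih, AddMonoidAlgebra.single_mul_single,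
      one_mul]

theorem translationEval_single_mul_prod {d : ℕ} (f : ℂ → ℂ) (a : ℂ) (v : Fin d → ℂ) :
    translationEval f (AddMonoidAlgebra.single a 1 *
      ∏ i, ((AddMonoidAlgebra.single (v i) 1 : AddMonoidAlgebra ℂ ℂ) - 1)) =
      opG v (fun x => f (a + x)) := by
  rw [prod_sub_one_eq_sum, Finset.mul_sum, map_sum, opG_eq_sum]
  refine Finset.sum_congr rfl fun S _ => ?_
  rw [← single_sum_one, mul_left_comm, AddMonoidAlgebra.single_mul_single, one_mul]
  have : ((-1 : AddMonoidAlgebra ℂ ℂ) ^ (d - S.card)) =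
      algebraMap ℂ (AddMonoidAlgebra ℂ ℂ) ((-1) ^ (d - S.card)) := by
    rw [map_pow, map_neg, map_one]
  rw [this, ← Algebra.smul_def, map_smul, translationEval_single, one_mul, smul_eq_mul]

/-- In the group algebra of translations, [M w_i] − 1 is the geometric sum ∑_{k<M} [k w_i] times
[w_i] − 1. Multiplying over i and expanding the product of sums produces exactly the cube. -/
theorem sum_cube_opG {d : ℕ} (w : Fin d → ℂ) (f : ℂ → ℂ) (M : ℕ) :
    ∑ n ∈ Fintype.piFinset (fun _ : Fin d => Finset.range M),
      opG w (fun x => f (dotW n w + x)) = opG w (fun x => f (M * x)) := by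
  have h1 : opG w (fun x => f (M * x)) = opG (fun i => (M : ℂ) * w i) (fun x => f (0 + x)) := by
    simp only [opG_eq_sum, Finset.mul_sum, zero_add]
  have h2 : ∀ i, (AddMonoidAlgebra.single ((M : ℂ) * w i) 1 : AddMonoidAlgebra ℂ ℂ) - 1 =
      (∑ k ∈ Finset.range M, AddMonoidAlgebra.single ((k : ℂ) * w i) 1) *
        (AddMonoidAlgebra.single (w i) 1 - 1) := by
    intro i
    have := geom_sum_mul (AddMonoidAlgebra.single (w i) (1 : ℂ)) M
    simp only [AddMonoidAlgebra.single_pow, one_pow, nsmul_eq_mul] at this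
    exact this.symm
  rw [h1, ← translationEval_single_mul_prod, Finset.prod_congr rfl fun i _ => h2 i,
    Finset.prod_mul_distrib, Finset.prod_univ_sum, Finset.sum_mul, Finset.mul_sum, map_sum]
  refine Finset.sum_congr rfl fun n _ => ?_
  rw [← translationEval_single_mul_prod, dotW, single_sum_one, ← mul_assoc,
    ← AddMonoidAlgebra.one_def, one_mul]

/-- The value f(0), at which powers and logarithms are singular, occurs with the same sign in the
full cube sum and in the term n = 0, and cancels. -/
theorem sum_puncturedCube_opG {d : ℕ} (w : Fin d → ℂ) (f : ℂ → ℂ) {M : ℕ} (hM : 0 < M) :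
    ∑ n ∈ puncturedCube d M, opG w (fun x => f (dotW n w + x)) =
      opF w (fun x => f (M * x)) - opF w f := by
  have h0 : (0 : Fin d → ℕ) ∈ Fintype.piFinset (fun _ : Fin d => Finset.range M) := by
    simpa [Fintype.mem_piFinset] using fun _ => hM
  have := Finset.sum_erase_add _ (fun n => opG w (fun x => f (dotW n w + x))) h0
  rw [sum_cube_opG] at this
  rw [puncturedCube, eq_sub_of_add_eq this, opF_eq_sub, opF_eq_sub]
  simp [dotW]

/-! ### Generating series: differences, Bernoulli polynomials and the numbers s_m -/

/-- The Taylor coefficients of `∏ i, (e^{w_i z} - 1)`. -/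
noncomputable def diffCoeff {d : ℕ} (w : Fin d → ℂ) (k : ℕ) : ℂ :=
  PowerSeries.coeff k (∏ i, (PowerSeries.rescale (w i) (PowerSeries.exp ℂ) - 1))

theorem prod_rescale_exp {ι : Type*} (s : Finset ι) (v : ι → ℂ) :
    ∏ i ∈ s, PowerSeries.rescale (v i) (PowerSeries.exp ℂ) =
      PowerSeries.rescale (∑ i ∈ s, v i) (PowerSeries.exp ℂ) := by
  classical
  induction s using Finset.induction_on with
  | empty => simp
  | insert a s ha ih =>
    rw [Finset.sum_insert ha, Finset.prod_insert ha, ih, PowerSeries.exp_mul_exp_eq_exp_add]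

theorem diffCoeff_eq {d : ℕ} (w : Fin d → ℂ) (k : ℕ) :
    diffCoeff w k = opG w (fun x => x ^ k / (k ! : ℂ)) := by
  rw [diffCoeff, prod_sub_one_eq_sum, opG_eq_sum, map_sum]
  refine Finset.sum_congr rfl fun S _ => ?_
  have : ((-1 : PowerSeries ℂ) ^ (d - S.card)) = PowerSeries.C ((-1) ^ (d - S.card)) := by simp
  rw [prod_rescale_exp, this, PowerSeries.coeff_C_mul, PowerSeries.coeff_rescale,
    PowerSeries.coeff_exp]
  simp [div_eq_mul_inv]

/-- Each factor e^{w_i z} − 1 is divisible by z. By `diffCoeff_eq` this says that the d-fold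
difference kills monomials of degree below d. -/
theorem diffCoeff_eq_zero {d : ℕ} (w : Fin d → ℂ) {k : ℕ} (hk : k < d) : diffCoeff w k = 0 := by
  have h : ∀ i, (PowerSeries.X : PowerSeries ℂ) ∣
      PowerSeries.rescale (w i) (PowerSeries.exp ℂ) - 1 := by
    intro i
    rw [PowerSeries.X_dvd_iff, map_sub, ← PowerSeries.coeff_zero_eq_constantCoeff_apply,
      PowerSeries.coeff_rescale]
    simp
  have h2 : (PowerSeries.X : PowerSeries ℂ) ^ d ∣
      ∏ i, (PowerSeries.rescale (w i) (PowerSeries.exp ℂ) - 1) := by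
    have := Finset.prod_dvd_prod_of_dvd (s := Finset.univ)
      (fun _ : Fin d => (PowerSeries.X : PowerSeries ℂ)) _ (fun i _ => h i)
    simpa using this
  exact PowerSeries.X_pow_dvd_iff.1 h2 k hk

/-- Only the factor e^{az} depends on a, and its derivative in a is z e^{az}. -/
theorem derivative_coeff_bernoulliGen {d : ℕ} (w : Fin d → ℂ) (n : ℕ) :
    derivative (PowerSeries.coeff (n + 1) (bernoulliGen w)) =
      PowerSeries.coeff n (bernoulliGen w) := by
  have h1 : ∏ i, PowerSeries.rescale (C (w i)) (bernoulliPowerSeries ℂ[X]) =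
      PowerSeries.map C (∏ i, PowerSeries.rescale (w i) (bernoulliPowerSeries ℂ)) := by
    rw [map_prod]
    refine Finset.prod_congr rfl fun i _ => ?_
    ext1 k
    simp [bernoulliPowerSeries, PowerSeries.coeff_rescale, Polynomial.algebraMap_apply]
  have h2 : ∀ i, derivative (PowerSeries.coeff (i + 1)
      (PowerSeries.rescale (X : ℂ[X]) (PowerSeries.exp ℂ[X]))) =
      PowerSeries.coeff i (PowerSeries.rescale (X : ℂ[X]) (PowerSeries.exp ℂ[X])) := by
    intro i
    have hi : ((i : ℂ) + 1) ≠ 0 := by exact_mod_cast Nat.succ_ne_zero i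
    have hi' : (i ! : ℂ) ≠ 0 := by exact_mod_cast Nat.factorial_ne_zero i
    simp only [PowerSeries.coeff_rescale, PowerSeries.coeff_exp, Polynomial.algebraMap_apply]
    rw [mul_comm, derivative_C_mul, derivative_X_pow, ← mul_assoc, mul_comm (X ^ i), ← C_mul]
    congr 2
    simp only [Nat.factorial_succ]
    push_cast
    simp
    field_simp
  have h3 : ∀ k, derivative (PowerSeries.coeff k
      (∏ i, PowerSeries.rescale (C (w i)) (bernoulliPowerSeries ℂ[X]))) = 0 := by
    intro k
    rw [h1, PowerSeries.coeff_map, derivative_C]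
  have h4 : derivative (PowerSeries.coeff 0
      (PowerSeries.rescale (X : ℂ[X]) (PowerSeries.exp ℂ[X]))) = 0 := by
    simp [PowerSeries.coeff_rescale]
  rw [bernoulliGen, PowerSeries.coeff_mul, PowerSeries.coeff_mul,
    Finset.Nat.sum_antidiagonal_succ, derivative_add, derivative_sum]
  simp only [derivative_mul, h2, h3, h4, zero_mul, mul_zero, add_zero, zero_add]

/-- One of the d derivatives undoes the primitive; the other d − 1 lower the Bernoulli index from m
+ d − 1 to m, and the factorials cancel. -/
theorem coeffS_eq {d : ℕ} (hd : 0 < d) (w : Fin d → ℂ) (m : ℕ) :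
    coeffS w m = (m ! : ℂ) * ((PowerSeries.coeff m (bernoulliGen w)).eval 0 / ∏ i, w i) := by
  obtain ⟨e, rfl⟩ : ∃ e, d = e + 1 := ⟨d - 1, by omega⟩
  have h : ∀ k n, derivative^[k] (PowerSeries.coeff (n + k) (bernoulliGen w)) =
      PowerSeries.coeff n (bernoulliGen w) := by
    intro k
    induction k with
    | zero => intro n; rfl
    | succ k ih =>
      intro n
      rw [Function.iterate_succ_apply, ← add_assoc, derivative_coeff_bernoulliGen, ih]
  have hf : ((m + e)! : ℂ) ≠ 0 := by exact_mod_cast Nat.factorial_ne_zero _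
  rw [coeffS, bernoullian, Function.iterate_succ_apply, derivative_primitive, bernoulliPoly,
    iterate_derivative_C_mul]
  have h3 : m + (e + 1) - 1 = m + e := by omega
  rw [h3, iterate_derivative_smul, h]
  simp
  field_simp

/-- The Taylor coefficients of `∏ i, z / (e^{w_i z} - 1)`. -/
noncomputable def toddCoeff {d : ℕ} (w : Fin d → ℂ) (m : ℕ) : ℂ :=
  coeffS w m / (m ! : ℂ)

/-- This is `bernoulliGen_mul` at a = 0 divided by ∏ w_i: the two series multiply to z^d. -/
theorem sum_toddCoeff_mul_diffCoeff {d : ℕ} (hd : 0 < d) (w : Fin d → ℂ) (hw : ∀ i, w i ≠ 0)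
    (j : ℕ) : ∑ p ∈ Finset.HasAntidiagonal.antidiagonal j, toddCoeff w p.1 * diffCoeff w p.2 =
      if j = d then 1 else 0 := by
  have hp : ∏ i, w i ≠ 0 := Finset.prod_ne_zero_iff.2 fun i _ => hw i
  have hr : ∀ a : ℂ[X], PowerSeries.map (evalRingHom (0 : ℂ))
      (PowerSeries.rescale a (PowerSeries.exp ℂ[X])) =
      PowerSeries.rescale (a.eval 0) (PowerSeries.exp ℂ) := by
    intro a
    ext1 k
    simp [PowerSeries.coeff_rescale, Polynomial.algebraMap_apply]
  have h := congrArg (PowerSeries.map (evalRingHom (0 : ℂ))) (bernoulliGen_mul w)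
  simp only [map_mul, map_prod, map_sub, map_one, hr, eval_C, eval_X, map_pow,
    PowerSeries.map_X, PowerSeries.map_C, coe_evalRingHom, PowerSeries.rescale_zero_apply] at h
  have h2 := congrArg (PowerSeries.coeff j) h
  rw [PowerSeries.constantCoeff_exp, map_one, mul_one, ← map_prod,
    PowerSeries.coeff_mul_C, PowerSeries.coeff_mul, PowerSeries.coeff_X_pow] at h2
  refine mul_right_cancel₀ hp (Eq.trans ?_ h2)
  rw [Finset.sum_mul]
  refine Finset.sum_congr rfl fun p _ => ?_
  have hf : (p.1 ! : ℂ) ≠ 0 := by exact_mod_cast Nat.factorial_ne_zero _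
  rw [toddCoeff, coeffS_eq hd, diffCoeff, PowerSeries.coeff_map, coe_evalRingHom]
  field_simp

theorem toddCoeff_zero_mul_diffCoeff {d : ℕ} (hd : 0 < d) (w : Fin d → ℂ) (hw : ∀ i, w i ≠ 0) :
    toddCoeff w 0 * diffCoeff w d = 1 := by
  have h := sum_toddCoeff_mul_diffCoeff hd w hw d
  rw [if_pos rfl] at h
  rw [← h, Finset.sum_eq_single (0, d)]
  · rintro ⟨i, j⟩ hij hne
    rw [Finset.HasAntidiagonal.mem_antidiagonal] at hij
    have : j < d := by
      rcases Nat.eq_zero_or_pos i with rfl | hi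
      · exact absurd (by simpa using hij) hne
      · simp at hij; omega
    simp [diffCoeff_eq_zero w this]
  · intro h; exact absurd (by simp) h

/-- `∏ i, (T_{w_i} - 1)` applied to `y ^ j / j!`. -/
theorem opG_add_pow {d : ℕ} (w : Fin d → ℂ) (x : ℂ) {j : ℕ} (hj : j ≤ d) :
    opG w (fun y => (x + y) ^ j / (j ! : ℂ)) = if j = d then diffCoeff w d else 0 := by
  have h : (fun y => (x + y) ^ j / (j ! : ℂ)) = fun y => ∑ p ∈ Finset.HasAntidiagonal.antidiagonal j,
      x ^ p.1 / (p.1 ! : ℂ) * (y ^ p.2 / (p.2 ! : ℂ)) := by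
    funext y
    rw [(Commute.all x y).add_pow', Finset.sum_div]
    refine Finset.sum_congr rfl fun p hp => ?_
    rw [Finset.HasAntidiagonal.mem_antidiagonal] at hp
    have h1 : (p.1 ! : ℂ) ≠ 0 := by exact_mod_cast Nat.factorial_ne_zero _
    have h2 : (p.2 ! : ℂ) ≠ 0 := by exact_mod_cast Nat.factorial_ne_zero _
    have h3 : (j ! : ℂ) ≠ 0 := by exact_mod_cast Nat.factorial_ne_zero _
    have h4 : (j.choose p.1 : ℂ) * p.1 ! * p.2 ! = j ! := by
      rw [← hp, Nat.choose_symm_add]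
      exact_mod_cast Nat.add_choose_mul_factorial_mul_factorial p.1 p.2
    rw [nsmul_eq_mul, ← h4]
    have h5 : (j.choose p.1 : ℂ) ≠ 0 := by
      intro h0; rw [h0] at h4; simp at h4; exact h3 h4.symm
    field_simp
  rw [h, opG_sum]
  simp only [opG_const_mul, ← diffCoeff_eq]
  split_ifs with hjd
  · subst hjd
    rw [Finset.sum_eq_single (0, j)]
    · simp
    · rintro ⟨i, k⟩ hik hne
      rw [Finset.HasAntidiagonal.mem_antidiagonal] at hik
      have : k < j := by
        rcases Nat.eq_zero_or_pos i with rfl | hi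
        · exact absurd (by simpa using hik) hne
        · simp at hik; omega
      simp [diffCoeff_eq_zero w this]
    · intro h; exact absurd (by simp) h
  · refine Finset.sum_eq_zero fun p hp => ?_
    rw [Finset.HasAntidiagonal.mem_antidiagonal] at hp
    rw [diffCoeff_eq_zero w (by omega), mul_zero]

/-- Unlike G, F does not kill constants, because the term at 0 is missing. This defect is the source
of the log M terms and of the residues. -/
theorem opF_pow {d : ℕ} (hd : 0 < d) (w : Fin d → ℂ) {j : ℕ} (hj : j ≤ d) :
    opF w (fun y => y ^ j / (j ! : ℂ)) =
      if j = 0 then -(-1 : ℂ) ^ d else if j = d then diffCoeff w d else 0 := by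
  have h := opG_add_pow w 0 hj
  simp only [zero_add] at h
  rw [opF_eq_sub, h]
  split_ifs with h1 h2 h2
  · omega
  · simp [h2]
  · simp [h2]
  · simp [h2]

/-! ### Taylor remainders and the truncated Euler–Maclaurin expansion -/

/-- Each function of the sequence is the derivative on `s` of its predecessor. -/
def IsDerivTower (s : Set ℂ) (f : ℕ → ℂ → ℂ) : Prop :=
  ∀ k, ∀ x ∈ s, HasDerivAt (f k) (f (k + 1) x) x

/-- Induction on the order: the derivative of a Taylor remainder is the remainder of one order less
for the shifted tower, and the mean value inequality on the segment integrates the bound. The factor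
1/K! is given up. -/
theorem IsDerivTower.norm_sub_taylor_le {s : Set ℂ} {C : ℝ} {x : ℂ} (K : ℕ) :
    ∀ {f : ℕ → ℂ → ℂ}, IsDerivTower s f → ∀ y, (∀ z ∈ segment ℝ x y, z ∈ s ∧ ‖f K z‖ ≤ C) →
      ‖f 0 y - ∑ k ∈ Finset.range K, f k x * ((y - x) ^ k / (k ! : ℂ))‖ ≤ C * ‖y - x‖ ^ K := by
  induction K with
  | zero =>
    intro f hf y h
    simpa using (h y (right_mem_segment ℝ x y)).2
  | succ K ih =>
    intro f hf y h
    have hC : 0 ≤ C := (norm_nonneg _).trans (h x (left_mem_segment ℝ x y)).2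
    have hd : ∀ z ∈ segment ℝ x y, HasDerivWithinAt
        (fun z => f 0 z - ∑ k ∈ Finset.range (K + 1), f k x * ((z - x) ^ k / (k ! : ℂ)))
        (f 1 z - ∑ k ∈ Finset.range K, f (k + 1) x * ((z - x) ^ k / (k ! : ℂ)))
        (segment ℝ x y) z := by
      intro z hz
      refine HasDerivAt.hasDerivWithinAt ((hf 0 z (h z hz).1).sub ?_)
      simp only [Finset.sum_range_succ' _ K]
      rw [← add_zero (∑ k ∈ Finset.range K, f (k + 1) x * ((z - x) ^ k / (k ! : ℂ)))]
      refine HasDerivAt.add (HasDerivAt.fun_sum fun k _ => ?_) ?_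
      · refine HasDerivAt.const_mul _ ?_
        have h1 := (((hasDerivAt_id z).sub_const x).pow (k + 1)).div_const ((k + 1)! : ℂ)
        refine h1.congr_deriv ?_
        have h2 : (k ! : ℂ) ≠ 0 := by exact_mod_cast Nat.factorial_ne_zero k
        have h3 : ((k : ℂ) + 1) ≠ 0 := by exact_mod_cast Nat.succ_ne_zero k
        rw [Nat.factorial_succ]
        push_cast
        simp only [id_eq]
        field_simp
      · simpa using hasDerivAt_const z (f 0 x)
    have hb : ∀ z ∈ segment ℝ x y,
        ‖f 1 z - ∑ k ∈ Finset.range K, f (k + 1) x * ((z - x) ^ k / (k ! : ℂ))‖ ≤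
          C * ‖y - x‖ ^ K := by
      intro z hz
      have hsub : segment ℝ x z ⊆ segment ℝ x y :=
        (convex_segment x y).segment_subset (left_mem_segment ℝ x y) hz
      refine (ih (f := fun k => f (k + 1)) (fun k => hf (k + 1)) z
        fun u hu => h u (hsub hu)).trans ?_
      gcongr
      obtain ⟨t, ht, rfl⟩ := (segment_eq_image' ℝ x y ▸ hz :
        z ∈ (fun t : ℝ => x + t • (y - x)) '' Set.Icc 0 1)
      rw [add_sub_cancel_left, norm_smul, Real.norm_of_nonneg ht.1]
      exact mul_le_of_le_one_left (norm_nonneg _) ht.2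
    have := (convex_segment (𝕜 := ℝ) x y).norm_image_sub_le_of_norm_hasDerivWithin_le hd hb
      (left_mem_segment ℝ x y) (right_mem_segment ℝ x y)
    rw [pow_succ, ← mul_assoc]
    refine le_trans (le_of_eq ?_) this
    congr 1
    simp [Finset.sum_range_succ']

/-- The term of the regularised sum of `f d` over the lattice cone: `f d` minus the difference
operator `∏ i, (T_{w_i} - 1)` of the truncated Euler–Maclaurin expansion. -/
noncomputable def regTerm {d : ℕ} (w : Fin d → ℂ) (N : ℕ) (f : ℕ → ℂ → ℂ) (x : ℂ) : ℂ :=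
  f d x - ∑ m ∈ Finset.range (N + 1), toddCoeff w m * opG w (fun y => f m (x + y))

/-- Grouping by j = m + k turns the double sum into the convolution of `toddCoeff` and `diffCoeff`,
which vanishes unless j = d. -/
theorem taylor_main_term {d : ℕ} (hd : 0 < d) (w : Fin d → ℂ) (hw : ∀ i, w i ≠ 0) (N : ℕ)
    (g : ℕ → ℂ) :
    ∑ m ∈ Finset.range (N + 1), toddCoeff w m *
      ∑ k ∈ Finset.range (d + N + 1 - m), g (m + k) * diffCoeff w k = g d := by
  -- The rows m > N can be added for free: in them k < d, where `diffCoeff` vanishes.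
  have h1 : ∑ m ∈ Finset.range (d + N + 1), toddCoeff w m *
      ∑ k ∈ Finset.range (d + N + 1 - m), g (m + k) * diffCoeff w k =
      ∑ m ∈ Finset.range (N + 1), toddCoeff w m *
      ∑ k ∈ Finset.range (d + N + 1 - m), g (m + k) * diffCoeff w k := by
    symm
    refine Finset.sum_subset (Finset.range_mono (by omega)) fun m _ hm => ?_
    rw [Finset.mem_range, not_lt] at hm
    rw [Finset.sum_eq_zero, mul_zero]
    intro k hk
    rw [Finset.mem_range] at hk
    rw [diffCoeff_eq_zero w (by omega), mul_zero]
  rw [← h1]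
  simp only [Finset.mul_sum]
  rw [← Finset.sum_range_diag_flip (d + N + 1)
    fun m k => toddCoeff w m * (g (m + k) * diffCoeff w k)]
  rw [Finset.sum_eq_single d]
  · have h := sum_toddCoeff_mul_diffCoeff hd w hw d
    rw [if_pos rfl, Finset.Nat.sum_antidiagonal_eq_sum_range_succ_mk] at h
    rw [← one_mul (g d), ← h, Finset.sum_mul]
    refine Finset.sum_congr rfl fun k hk => ?_
    rw [Finset.mem_range] at hk
    rw [show k + (d - k) = d by omega]
    ring
  · intro j _ hj
    have h := sum_toddCoeff_mul_diffCoeff hd w hw j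
    rw [if_neg hj, Finset.Nat.sum_antidiagonal_eq_sum_range_succ_mk] at h
    rw [← zero_mul (g j), ← h, Finset.sum_mul]
    refine Finset.sum_congr rfl fun k hk => ?_
    rw [Finset.mem_range] at hk
    rw [show k + (j - k) = j by omega]
    ring
  · intro h; exact absurd (Finset.mem_range.2 (by omega)) h

/-- Expanding f_m to order d + N + 1 − m makes every remainder involve the same derivative
f_{d+N+1}, and the main terms add up to f_d. The constant depends on w and N only, which later gives
uniformity in the apex and in α. -/
theorem exists_norm_regTerm_le {d : ℕ} (hd : 0 < d) (w : Fin d → ℂ) (hw : ∀ i, w i ≠ 0) (N : ℕ) :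
    ∃ A : ℝ, 0 ≤ A ∧ ∀ (s : Set ℂ) (f : ℕ → ℂ → ℂ) (x : ℂ) (C : ℝ), IsDerivTower s f →
      (∀ S : Finset (Fin d), ∀ z ∈ segment ℝ x (x + ∑ i ∈ S, w i),
        z ∈ s ∧ ‖f (d + N + 1) z‖ ≤ C) →
      ‖regTerm w N f x‖ ≤ A * C := by
  refine ⟨∑ m ∈ Finset.range (N + 1), ‖toddCoeff w m‖ *
    ∑ S : Finset (Fin d), ‖∑ i ∈ S, w i‖ ^ (d + N + 1 - m), by positivity, ?_⟩
  intro s f x C hf h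
  have hmain := taylor_main_term hd w hw N fun k => f k x
  have h2 : ∀ m, opG w (fun y => f m (x + y)) - ∑ k ∈ Finset.range (d + N + 1 - m),
      f (m + k) x * diffCoeff w k = opG w (fun y => f m (x + y) -
        ∑ k ∈ Finset.range (d + N + 1 - m), f (m + k) x * (y ^ k / (k ! : ℂ))) := by
    intro m
    rw [opG_sub, opG_sum]
    simp only [opG_const_mul, diffCoeff_eq]
  have h3 : regTerm w N f x = -∑ m ∈ Finset.range (N + 1), toddCoeff w m *
      opG w (fun y => f m (x + y) -
        ∑ k ∈ Finset.range (d + N + 1 - m), f (m + k) x * (y ^ k / (k ! : ℂ))) := by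
    simp only [← h2, mul_sub, Finset.sum_sub_distrib]
    rw [hmain, regTerm]
    ring
  rw [h3, norm_neg, Finset.sum_mul]
  refine (norm_sum_le _ _).trans (Finset.sum_le_sum fun m hm => ?_)
  rw [Finset.mem_range] at hm
  rw [norm_mul, mul_assoc]
  refine mul_le_mul_of_nonneg_left ?_ (norm_nonneg _)
  rw [opG_eq_sum, Finset.sum_mul]
  refine (norm_sum_le _ _).trans (Finset.sum_le_sum fun S _ => ?_)
  rw [norm_mul, norm_pow, norm_neg, norm_one, one_pow, one_mul, mul_comm]
  have := IsDerivTower.norm_sub_taylor_le (C := C) (x := x) (s := s) (d + N + 1 - m)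
    (f := fun k => f (m + k)) (fun k => hf (m + k)) (x + ∑ i ∈ S, w i) (by
      intro z hz
      rw [show m + (d + N + 1 - m) = d + N + 1 by omega]
      exact h S z hz)
  simpa using this

/-! ### Regularised sums over the punctured cone -/

/-- The regularised sum of `f d` over the punctured lattice cone with apex `a`. -/
noncomputable def regSum {d : ℕ} (w : Fin d → ℂ) (N : ℕ) (f : ℕ → ℂ → ℂ) (a : ℂ) : ℂ :=
  -∑ m ∈ Finset.range (N + 1), toddCoeff w m * opF w (fun y => f m (a + y)) +
    ∑' n : {n : Fin d → ℕ // n ≠ 0}, regTerm w N f (a + dotW n.1 w)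

/-- The punctured cubes increase and exhaust the index set, so they are cofinal among its finite
subsets. -/
theorem tendsto_sum_puncturedCube {d : ℕ} {f : (Fin d → ℕ) → ℂ} {s : ℂ}
    (h : HasSum (fun n : {n : Fin d → ℕ // n ≠ 0} => f n.1) s) :
    Tendsto (fun M : ℕ => ∑ n ∈ puncturedCube d M, f n) atTop (𝓝 s) := by
  have h1 : ∀ M : ℕ, ∑ n ∈ (puncturedCube d M).subtype (fun n => n ≠ 0), f n.1 =
      ∑ n ∈ puncturedCube d M, f n := by
    intro M
    rw [Finset.sum_subtype_eq_sum_filter, Finset.filter_true_of_mem]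
    intro n hn
    exact Finset.ne_of_mem_erase hn
  rw [HasSum, SummationFilter.unconditional_filter] at h
  refine Tendsto.congr h1 (h.comp ?_)
  refine tendsto_atTop_finset_of_monotone ?_ ?_
  · intro M M' hM n hn
    simp only [puncturedCube, Finset.mem_subtype, Finset.mem_erase, Fintype.mem_piFinset,
      Finset.mem_range] at hn ⊢
    exact ⟨hn.1, fun i => (hn.2 i).trans_le hM⟩
  · intro n
    refine ⟨∑ i, n.1 i + 1, ?_⟩
    simp only [puncturedCube, Finset.mem_subtype, Finset.mem_erase, Fintype.mem_piFinset,
      Finset.mem_range]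
    exact ⟨n.2, fun i => Nat.lt_succ_of_le
      (Finset.single_le_sum (f := n.1) (fun _ _ => Nat.zero_le _) (Finset.mem_univ i))⟩

/-- The differences telescope over the cube to boundary terms at scale M minus those at scale 1; the
latter are cancelled by the finite sum built into `regSum`. -/
theorem tendsto_regSum {d : ℕ} (w : Fin d → ℂ) (N : ℕ) (f : ℕ → ℂ → ℂ) (a : ℂ)
    (h : Summable fun n : {n : Fin d → ℕ // n ≠ 0} => regTerm w N f (a + dotW n.1 w)) :
    Tendsto (fun M : ℕ => ∑ n ∈ puncturedCube d M, f d (a + dotW n w) -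
      ∑ m ∈ Finset.range (N + 1), toddCoeff w m * opF w (fun y => f m (a + M * y)))
      atTop (𝓝 (regSum w N f a)) := by
  have h1 := (tendsto_sum_puncturedCube (f := fun n => regTerm w N f (a + dotW n w))
    h.hasSum).const_add
      (-∑ m ∈ Finset.range (N + 1), toddCoeff w m * opF w (fun y => f m (a + y)))
  refine h1.congr' ?_
  filter_upwards [eventually_gt_atTop 0] with M hM
  have h2 : ∀ m, ∑ n ∈ puncturedCube d M, opG w (fun y => f m (a + dotW n w + y)) =
      opF w (fun y => f m (a + M * y)) - opF w (fun y => f m (a + y)) := by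
    intro m
    rw [← sum_puncturedCube_opG w (fun y => f m (a + y)) hM]
    simp only [add_assoc]
  simp only [regTerm, Finset.sum_sub_distrib]
  rw [Finset.sum_comm]
  simp only [← Finset.mul_sum, h2, mul_sub, Finset.sum_sub_distrib]
  ring

/-- The regularised sum does not depend on the order of truncation. -/
theorem regSum_eq_of_tendsto_zero {d : ℕ} (w : Fin d → ℂ) {N N' : ℕ} (hN : N ≤ N')
    (f : ℕ → ℂ → ℂ) (a : ℂ)
    (h : Summable fun n : {n : Fin d → ℕ // n ≠ 0} => regTerm w N f (a + dotW n.1 w))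
    (h' : Summable fun n : {n : Fin d → ℕ // n ≠ 0} => regTerm w N' f (a + dotW n.1 w))
    (h0 : ∀ m, N < m → Tendsto (fun M : ℕ => opF w (fun y => f m (a + M * y))) atTop (𝓝 0)) :
    regSum w N' f a = regSum w N f a := by
  have h1 : Tendsto (fun M : ℕ => ∑ m ∈ Finset.Ico (N + 1) (N' + 1),
      toddCoeff w m * opF w (fun y => f m (a + M * y))) atTop (𝓝 0) := by
    have := tendsto_finsetSum (Finset.Ico (N + 1) (N' + 1)) fun m hm =>
      (h0 m (by rw [Finset.mem_Ico] at hm; omega)).const_mul (toddCoeff w m)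
    simpa using this
  have h2 := (tendsto_regSum w N f a h).sub h1
  rw [sub_zero] at h2
  refine tendsto_nhds_unique (tendsto_regSum w N' f a h') (h2.congr fun M => ?_)
  rw [← Finset.sum_range_add_sum_Ico _ (show N + 1 ≤ N' + 1 by omega)]
  ring

/-! ### Geometry of the half-plane and summable majorants -/

/-- The signed distance of `z` from the boundary line of `halfPlane θ`. -/
noncomputable def height (θ : ℝ) (z : ℂ) : ℝ := (z * Complex.exp (-(θ * Complex.I))).re

theorem mem_halfPlane {θ : ℝ} {z : ℂ} : z ∈ halfPlane θ ↔ 0 < height θ z := Iff.rfl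

theorem norm_exp_neg_mul_I (θ : ℝ) : ‖Complex.exp (-(θ * Complex.I))‖ = 1 := by
  rw [Complex.norm_exp]; simp

theorem height_add (θ : ℝ) (x y : ℂ) : height θ (x + y) = height θ x + height θ y := by
  simp [height, add_mul]

theorem height_real_mul (θ t : ℝ) (x : ℂ) : height θ (t * x) = t * height θ x := by
  rw [height, mul_assoc, Complex.re_ofReal_mul, height]

theorem height_natCast_mul (θ : ℝ) (t : ℕ) (x : ℂ) : height θ (t * x) = t * height θ x := by
  exact_mod_cast height_real_mul θ t x

theorem height_sum (θ : ℝ) {ι : Type*} (s : Finset ι) (f : ι → ℂ) :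
    height θ (∑ i ∈ s, f i) = ∑ i ∈ s, height θ (f i) := by
  simp [height, Finset.sum_mul]

theorem height_dotW (θ : ℝ) {d : ℕ} (n : Fin d → ℕ) (w : Fin d → ℂ) :
    height θ (dotW n w) = ∑ i, n i * height θ (w i) := by
  simp only [dotW, height_sum, height_natCast_mul]

theorem abs_height_le (θ : ℝ) (z : ℂ) : |height θ z| ≤ ‖z‖ := by
  refine (Complex.abs_re_le_norm _).trans ?_
  rw [norm_mul, norm_exp_neg_mul_I, mul_one]

theorem continuous_height (θ : ℝ) : Continuous (height θ) := by
  unfold height; fun_prop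

theorem isOpen_halfPlane (θ : ℝ) : IsOpen (halfPlane θ) :=
  isOpen_lt continuous_const (continuous_height θ)

theorem ne_zero_of_mem_halfPlane {θ : ℝ} {z : ℂ} (hz : z ∈ halfPlane θ) : z ≠ 0 := by
  rintro rfl
  simp [halfPlane] at hz

theorem sum_mem_halfPlane {θ : ℝ} {d : ℕ} {w : Fin d → ℂ} (hw : ∀ i, w i ∈ halfPlane θ)
    {S : Finset (Fin d)} (hS : S.Nonempty) : ∑ i ∈ S, w i ∈ halfPlane θ := by
  rw [mem_halfPlane, height_sum]
  exact Finset.sum_pos (fun i _ => hw i) hS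

theorem height_sum_nonneg {θ : ℝ} {d : ℕ} {w : Fin d → ℂ} (hw : ∀ i, w i ∈ halfPlane θ)
    (S : Finset (Fin d)) : 0 ≤ height θ (∑ i ∈ S, w i) := by
  rw [height_sum]
  exact Finset.sum_nonneg fun i _ => (mem_halfPlane.1 (hw i)).le

/-- The half-plane of those `a` for which `a + n · w` lies in `halfPlane θ` for all `n ≠ 0`. -/
def coneDomain (θ : ℝ) {d : ℕ} (w : Fin d → ℂ) : Set ℂ := {a | ∀ i, a + w i ∈ halfPlane θ}

theorem isOpen_coneDomain (θ : ℝ) {d : ℕ} (w : Fin d → ℂ) : IsOpen (coneDomain θ w) := by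
  rw [coneDomain, Set.ofPred_forall]
  exact isOpen_iInter_of_finite fun i =>
    (isOpen_halfPlane θ).preimage (continuous_id.add continuous_const)

theorem halfPlane_subset_coneDomain {θ : ℝ} {d : ℕ} {w : Fin d → ℂ}
    (hw : ∀ i, w i ∈ halfPlane θ) : halfPlane θ ⊆ coneDomain θ w := by
  intro a ha i
  rw [mem_halfPlane, height_add]
  exact add_pos ha (hw i)

theorem zero_mem_coneDomain {θ : ℝ} {d : ℕ} {w : Fin d → ℂ}
    (hw : ∀ i, w i ∈ halfPlane θ) : 0 ∈ coneDomain θ w := by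
  intro i
  rw [zero_add]
  exact hw i

/-- Heights are additive, so a + n·w moves away from the boundary line linearly in ∑ n_i, uniformly
for apices near a; adding a subset sum of the w_i can only increase the height. -/
theorem exists_height_bound {θ : ℝ} {d : ℕ} {w : Fin d → ℂ} (hw : ∀ i, w i ∈ halfPlane θ)
    {a : ℂ} (ha : a ∈ coneDomain θ w) :
    ∃ c > 0, ∃ δ > 0, ∀ a' ∈ Metric.ball a δ, ∀ n : Fin d → ℕ, n ≠ 0 → ∀ S : Finset (Fin d),
      ∀ z ∈ segment ℝ (a' + dotW n w) (a' + dotW n w + ∑ i ∈ S, w i),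
        c * (1 + ∑ i, (n i : ℝ)) ≤ height θ z := by
  obtain ⟨ε, hε, h1, h2⟩ : ∃ ε > 0, (∀ i, ε ≤ height θ (w i)) ∧ ∀ i, ε ≤ height θ (a + w i) := by
    have h : ∀ g : Fin d → ℝ, (∀ i, 0 < g i) → ∃ ε > 0, ∀ i, ε ≤ g i := by
      intro g hg
      rcases isEmpty_or_nonempty (Fin d) with he | he
      · exact ⟨1, one_pos, fun i => he.elim i⟩
      · obtain ⟨i, hi⟩ := Finite.exists_min g
        exact ⟨g i, hg i, hi⟩
    obtain ⟨ε₁, hε₁, h₁⟩ := h _ hw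
    obtain ⟨ε₂, hε₂, h₂⟩ := h _ ha
    exact ⟨min ε₁ ε₂, lt_min hε₁ hε₂, fun i => (min_le_left _ _).trans (h₁ i),
      fun i => (min_le_right _ _).trans (h₂ i)⟩
  -- Choose i with n_i ≥ 1 and write a + n·w as a + w_i plus the rest: its height is at least ε|n|,
  -- where |n| = ∑ n_j. Moving the apex costs at most ε/2, and ε|n| − ε/2 ≥ (ε/4)(1 + |n|) because
  -- |n| ≥ 1.
  refine ⟨ε / 4, by positivity, ε / 2, by positivity, ?_⟩
  intro a' ha' n hn S z hz
  obtain ⟨i, hi⟩ : ∃ i, n i ≠ 0 := Function.ne_iff.1 hn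
  have hi1 : (1 : ℝ) ≤ n i := by exact_mod_cast Nat.one_le_iff_ne_zero.2 hi
  have h3 : height θ (a' + dotW n w) ≤ height θ z := by
    rw [segment_eq_image'] at hz
    obtain ⟨t, ht, rfl⟩ := hz
    rw [add_sub_cancel_left]
    simp only [Complex.real_smul]
    rw [height_add _ (a' + dotW n w), height_real_mul]
    have := mul_nonneg ht.1 (height_sum_nonneg hw S)
    linarith
  have h4 : height θ (a' - a) ≥ -(ε / 2) := by
    have := abs_le.1 ((abs_height_le θ (a' - a)).trans (mem_ball_iff_norm.1 ha').le)
    exact this.1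
  have h5 : height θ a' = height θ a + height θ (a' - a) := by
    rw [← height_add]; simp
  have h6 : ε * ∑ j, (n j : ℝ) - ε ≤ ∑ j, n j * height θ (w j) - height θ (w i) := by
    have hs : ∑ j, (n j : ℝ) * (height θ (w j) - ε) ≥ height θ (w i) - ε := by
      have hle : (n i : ℝ) * (height θ (w i) - ε) ≤ ∑ j, (n j : ℝ) * (height θ (w j) - ε) :=
        Finset.single_le_sum (f := fun j => (n j : ℝ) * (height θ (w j) - ε))
          (fun j _ => mul_nonneg (Nat.cast_nonneg _) (sub_nonneg.2 (h1 j))) (Finset.mem_univ i)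
      have := le_mul_of_one_le_left (sub_nonneg.2 (h1 i)) hi1
      linarith
    simp only [mul_sub, Finset.sum_sub_distrib, ← Finset.sum_mul] at hs
    linarith
  have h7 := h2 i
  have h8 : (1 : ℝ) ≤ ∑ j, (n j : ℝ) :=
    hi1.trans (Finset.single_le_sum (f := fun j => (n j : ℝ)) (fun _ _ => Nat.cast_nonneg _)
      (Finset.mem_univ i))
  rw [height_add] at h7
  rw [height_add, height_dotW] at h3
  nlinarith [mul_le_mul_of_nonneg_left h8 hε.le]

/-- Since 1 + ∑ n_i ≥ 1 + n_j for each j, the term is at most ∏ (1 + n_j)^(−σ/d), a product of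
one-variable convergent series with exponent σ/d > 1. -/
theorem summable_one_add_sum_rpow {d : ℕ} {σ : ℝ} (hσ : (d : ℝ) < σ) :
    Summable fun n : Fin d → ℕ => (1 + ∑ i, (n i : ℝ)) ^ (-σ) := by
  rcases Nat.eq_zero_or_pos d with rfl | hd
  · exact Summable.of_finite
  have hd' : (0 : ℝ) < d := by exact_mod_cast hd
  have hp : Summable fun k : ℕ => ((k : ℝ) + 1) ^ (-(σ / d)) := by
    have h := (summable_nat_add_iff 1).2
      (Real.summable_nat_rpow.2 (show -(σ / d) < -1 by rw [neg_lt_neg_iff, one_lt_div hd']; exact hσ))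
    simpa using h
  have hle : ∀ n : Fin d → ℕ,
      (1 + ∑ i, (n i : ℝ)) ^ (-σ) ≤ ∏ i, ((n i : ℝ) + 1) ^ (-(σ / d)) := by
    intro n
    have h0 : 0 ≤ ∑ i, (n i : ℝ) := Finset.sum_nonneg fun _ _ => Nat.cast_nonneg _
    have : (1 + ∑ i, (n i : ℝ)) ^ (-σ) = ∏ _i : Fin d, (1 + ∑ i, (n i : ℝ)) ^ (-(σ / d)) := by
      rw [Finset.prod_const, Finset.card_univ, Fintype.card_fin, ← Real.rpow_mul_natCast (by linarith)]
      congr 1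
      field_simp
    rw [this]
    refine Finset.prod_le_prod (fun _ _ => by positivity) fun i _ => ?_
    refine Real.rpow_le_rpow_of_nonpos (by positivity) ?_ (neg_nonpos.2 (by
      exact div_nonneg (by linarith) hd'.le))
    have := Finset.single_le_sum (f := fun j => (n j : ℝ)) (fun _ _ => Nat.cast_nonneg _)
      (Finset.mem_univ i)
    linarith
  refine Summable.of_nonneg_of_le (fun n => ?_) hle ?_
  · exact Real.rpow_nonneg (add_nonneg zero_le_one
      (Finset.sum_nonneg fun _ _ => Nat.cast_nonneg _)) _
  -- Every finite index set lies in a cube, over which the sum of products factors into a d-th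
  -- power.
  refine summable_of_sum_le (c := (∑' k : ℕ, ((k : ℝ) + 1) ^ (-(σ / d))) ^ d)
    (fun n => Finset.prod_nonneg fun i _ => by positivity) fun u => ?_
  have hsub : u ⊆ Fintype.piFinset (fun _ : Fin d => Finset.range (u.sup (fun n => ∑ i, n i) + 1)) := by
    intro n hn
    rw [Fintype.mem_piFinset]
    intro i
    rw [Finset.mem_range, Nat.lt_succ_iff]
    exact (Finset.single_le_sum (f := n) (fun _ _ => Nat.zero_le _) (Finset.mem_univ i)).trans
      (Finset.le_sup (f := fun n : Fin d → ℕ => ∑ i, n i) hn)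
  refine (Finset.sum_le_sum_of_subset_of_nonneg hsub fun n _ _ =>
    Finset.prod_nonneg fun i _ => by positivity).trans ?_
  rw [← Finset.prod_univ_sum (fun _ : Fin d => Finset.range (u.sup (fun n => ∑ i, n i) + 1))
    (fun _ k => ((k : ℝ) + 1) ^ (-(σ / d))), Finset.prod_const, Finset.card_univ, Fintype.card_fin]
  refine pow_le_pow_left₀ (Finset.sum_nonneg fun _ _ => by positivity) ?_ d
  exact hp.sum_le_tsum _ fun _ _ => by positivity

/-- One ball around the apex and one majorant serve all towers at once; only the constant K depends
on the tower. -/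
theorem exists_summable_bound {θ : ℝ} {d : ℕ} (hd : 0 < d) {w : Fin d → ℂ}
    (hw : ∀ i, w i ∈ halfPlane θ) {a : ℂ} (ha : a ∈ coneDomain θ w) (N : ℕ) {σ : ℝ}
    (hσ : (d : ℝ) < σ) :
    ∃ c > 0, ∃ δ > 0, ∃ u : {n : Fin d → ℕ // n ≠ 0} → ℝ, Summable u ∧
      Metric.ball a δ ⊆ coneDomain θ w ∧
      (∀ a' ∈ Metric.ball a δ, ∀ n : {n : Fin d → ℕ // n ≠ 0},
        a' + dotW n.1 w ∈ halfPlane θ ∧ ‖a' + dotW n.1 w‖ ^ (-σ) ≤ u n) ∧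
      ∀ (f : ℕ → ℂ → ℂ) (K : ℝ), 0 ≤ K → IsDerivTower (halfPlane θ) f →
        (∀ z ∈ halfPlane θ, c ≤ ‖z‖ → ‖f (d + N + 1) z‖ ≤ K * ‖z‖ ^ (-σ)) →
        ∀ a' ∈ Metric.ball a δ, ∀ n : {n : Fin d → ℕ // n ≠ 0},
          ‖regTerm w N f (a' + dotW n.1 w)‖ ≤ K * u n := by
  obtain ⟨c, hc, δ, hδ, hb⟩ := exists_height_bound hw ha
  obtain ⟨A, hA, hreg⟩ := exists_norm_regTerm_le hd w
    (fun i => ne_zero_of_mem_halfPlane (hw i)) N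
  obtain ⟨δ', hδ', hball⟩ := Metric.isOpen_iff.1 (isOpen_coneDomain θ w) a ha
  have hpos : ∀ n : Fin d → ℕ, 1 ≤ 1 + ∑ i, (n i : ℝ) := fun n =>
    le_add_of_nonneg_right (Finset.sum_nonneg fun _ _ => Nat.cast_nonneg _)
  have hσ0 : 0 < σ := (Nat.cast_nonneg d).trans_lt hσ
  have hz : ∀ a' ∈ Metric.ball a (min δ δ'), ∀ n : {n : Fin d → ℕ // n ≠ 0},
      ∀ S : Finset (Fin d),
      ∀ z ∈ segment ℝ (a' + dotW n.1 w) (a' + dotW n.1 w + ∑ i ∈ S, w i), z ∈ halfPlane θ ∧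
        c ≤ ‖z‖ ∧ ‖z‖ ^ (-σ) ≤ c ^ (-σ) * (1 + ∑ i, (n.1 i : ℝ)) ^ (-σ) := by
    intro a' ha' n S z hz
    have h1 := hb a' (Metric.ball_subset_ball (min_le_left _ _) ha') n.1 n.2 S z hz
    have h2 := (le_abs_self _).trans (abs_height_le θ z)
    have h3 : 0 < c * (1 + ∑ i, (n.1 i : ℝ)) := mul_pos hc (one_pos.trans_le (hpos n.1))
    refine ⟨h3.trans_le h1, ?_, ?_⟩
    · exact ((le_mul_of_one_le_right hc.le (hpos n.1)).trans h1).trans h2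
    · rw [← Real.mul_rpow hc.le (zero_le_one.trans (hpos n.1))]
      exact Real.rpow_le_rpow_of_nonpos h3 (h1.trans h2) (neg_nonpos.2 hσ0.le)
  have hB : ∀ n : {n : Fin d → ℕ // n ≠ 0}, 0 ≤ c ^ (-σ) * (1 + ∑ i, (n.1 i : ℝ)) ^ (-σ) :=
    fun n => mul_nonneg (Real.rpow_nonneg hc.le _) (Real.rpow_nonneg (zero_le_one.trans (hpos n.1)) _)
  -- The factor A + 1 dominates both the factor A needed for `regTerm` and the factor 1 needed for
  -- the plain powers.
  refine ⟨c, hc, min δ δ', lt_min hδ hδ', fun n => (A + 1) * (c ^ (-σ) * (1 + ∑ i, (n.1 i : ℝ)) ^ (-σ)),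
    ?_, (Metric.ball_subset_ball (min_le_right _ _)).trans hball, ?_, ?_⟩
  · exact (((summable_one_add_sum_rpow hσ).subtype _).mul_left _).mul_left _
  · intro a' ha' n
    have := hz a' ha' n ∅ _ (left_mem_segment ℝ _ _)
    exact ⟨this.1, this.2.2.trans (le_mul_of_one_le_left (hB n) (by linarith))⟩
  · intro f K hK hf hfb a' ha' n
    refine (hreg (halfPlane θ) f (a' + dotW n.1 w)
      (K * (c ^ (-σ) * (1 + ∑ i, (n.1 i : ℝ)) ^ (-σ))) hf fun S z hzs => ?_).trans ?_
    · obtain ⟨h1, h2, h3⟩ := hz a' ha' n S z hzs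
      exact ⟨h1, (hfb z h1 h2).trans (mul_le_mul_of_nonneg_left h3 hK)⟩
    · rw [mul_left_comm]
      refine mul_le_mul_of_nonneg_left ?_ hK
      exact mul_le_mul_of_nonneg_right (by linarith) (hB n)

theorem tendsto_opF_zero {θ : ℝ} {d : ℕ} {w : Fin d → ℂ} (hw : ∀ i, w i ∈ halfPlane θ) (a : ℂ)
    {g : ℂ → ℂ} {K σ : ℝ} (hσ : 0 < σ) (hg : ∀ z ∈ halfPlane θ, ‖g z‖ ≤ K * ‖z‖ ^ (-σ)) :
    Tendsto (fun M : ℕ => opF w (fun y => g (a + M * y))) atTop (𝓝 0) := by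
  unfold opF
  rw [show (0 : ℂ) = ∑ S : Finset (Fin d) with S.Nonempty, (-1 : ℂ) ^ (d - S.card) * 0 by simp]
  refine tendsto_finsetSum _ fun S hS => Tendsto.const_mul _ ?_
  have hS' := sum_mem_halfPlane hw (Finset.mem_filter.1 hS).2
  have hh : Tendsto (fun M : ℕ => height θ (a + M * ∑ i ∈ S, w i)) atTop atTop := by
    simp only [height_add, height_natCast_mul]
    exact tendsto_atTop_add_const_left _ _
      (Tendsto.atTop_mul_const hS' tendsto_natCast_atTop_atTop)
  have hn : Tendsto (fun M : ℕ => ‖a + M * ∑ i ∈ S, w i‖) atTop atTop :=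
    tendsto_atTop_mono (fun M => (le_abs_self _).trans (abs_height_le θ _)) hh
  have h0 : Tendsto (fun M : ℕ => K * ‖a + M * ∑ i ∈ S, w i‖ ^ (-σ)) atTop (𝓝 0) := by
    simpa using ((tendsto_rpow_neg_atTop hσ).comp hn).const_mul K
  refine squeeze_zero_norm' ?_ h0
  filter_upwards [hh.eventually_gt_atTop 0] with M hM
  exact hg _ hM

/-! ### The branches of logarithm and power -/

theorem exp_branchLog {θ : ℝ} {z : ℂ} (hz : z ≠ 0) : Complex.exp (branchLog θ z) = z := by
  rw [branchLog, Complex.exp_add, Complex.exp_log (mul_ne_zero hz (Complex.exp_ne_zero _)),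
    mul_assoc, ← Complex.exp_add]
  simp

theorem hasDerivAt_branchLog {θ : ℝ} {z : ℂ} (hz : z ∈ halfPlane θ) :
    HasDerivAt (branchLog θ) z⁻¹ z := by
  have h := ((hasDerivAt_id z).mul_const (Complex.exp (-(θ * Complex.I)))).clog
    (Or.inl hz)
  refine (h.add_const (θ * Complex.I)).congr_deriv ?_
  have := ne_zero_of_mem_halfPlane hz
  have := Complex.exp_ne_zero (-(θ * Complex.I))
  simp only [id_eq]
  field_simp

theorem branchLog_real_mul {θ t : ℝ} (ht : 0 < t) {z : ℂ} (hz : z ≠ 0) :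
    branchLog θ (t * z) = Real.log t + branchLog θ z := by
  rw [branchLog, mul_assoc, Complex.log_ofReal_mul ht (mul_ne_zero hz (Complex.exp_ne_zero _)),
    branchLog, add_assoc]

theorem branchPow_add {θ : ℝ} (z s t : ℂ) :
    branchPow θ z (s + t) = branchPow θ z s * branchPow θ z t := by
  rw [branchPow, add_mul, Complex.exp_add, branchPow, branchPow]

theorem branchPow_natCast {θ : ℝ} {z : ℂ} (hz : z ≠ 0) (k : ℕ) :
    branchPow θ z k = z ^ k := by
  rw [branchPow, Complex.exp_nat_mul, exp_branchLog hz]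

theorem branchPow_neg {θ : ℝ} (z s : ℂ) : branchPow θ z (-s) = (branchPow θ z s)⁻¹ := by
  rw [branchPow, neg_mul, Complex.exp_neg, branchPow]

theorem branchPow_sub_one {θ : ℝ} {z : ℂ} (hz : z ≠ 0) (s : ℂ) :
    branchPow θ z (s - 1) = branchPow θ z s * z⁻¹ := by
  rw [sub_eq_add_neg, branchPow_add, branchPow_neg]
  have := branchPow_natCast (θ := θ) hz 1
  rw [Nat.cast_one, pow_one] at this
  rw [this]

theorem hasDerivAt_branchPow {θ : ℝ} {z : ℂ} (hz : z ∈ halfPlane θ) (s : ℂ) :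
    HasDerivAt (fun z => branchPow θ z s) (s * branchPow θ z (s - 1)) z := by
  refine (((hasDerivAt_branchLog hz).const_mul s).cexp).congr_deriv ?_
  rw [branchPow_sub_one (ne_zero_of_mem_halfPlane hz), branchPow]
  ring

theorem hasDerivAt_branchPow_exponent (θ : ℝ) (z s : ℂ) :
    HasDerivAt (fun s => branchPow θ z s) (branchLog θ z * branchPow θ z s) s := by
  refine (((hasDerivAt_id s).mul_const (branchLog θ z)).cexp).congr_deriv ?_
  rw [branchPow]
  simp only [id_eq]
  ring

theorem norm_branchPow_le {θ : ℝ} {z : ℂ} (hz : z ≠ 0) (s : ℂ) :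
    ‖branchPow θ z s‖ ≤ ‖z‖ ^ s.re * Real.exp (|s.im| * (|θ| + Real.pi)) := by
  have hz' : z * Complex.exp (-(θ * Complex.I)) ≠ 0 := mul_ne_zero hz (Complex.exp_ne_zero _)
  have hre : (branchLog θ z).re = Real.log ‖z‖ := by
    rw [branchLog, Complex.add_re, Complex.log_re, norm_mul, norm_exp_neg_mul_I]
    simp
  have him : |(branchLog θ z).im| ≤ |θ| + Real.pi := by
    rw [branchLog, Complex.add_im, Complex.log_im, add_comm |θ|]
    refine (abs_add_le _ _).trans (add_le_add (Complex.abs_arg_le_pi _) ?_)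
    simp
  rw [branchPow, Complex.norm_exp, Complex.mul_re, hre, Real.rpow_def_of_pos (norm_pos_iff.2 hz),
    ← Real.exp_add, Real.exp_le_exp]
  have h1 : -(s.im * (branchLog θ z).im) ≤ |s.im| * (|θ| + Real.pi) := by
    refine (neg_le_abs _).trans ?_
    rw [abs_mul]
    exact mul_le_mul_of_nonneg_left him (abs_nonneg _)
  linarith

/-! ### Harmonic numbers as logarithmic derivatives of products -/

theorem harm_eq_sum (k : ℕ) : harm k = ∑ i ∈ Finset.range k, ((i : ℂ) + 1)⁻¹ := by
  simp [harm, harmonic]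

theorem harm_zero : harm 0 = 0 := by simp [harm]

theorem harm_succ (k : ℕ) : harm (k + 1) = harm k + ((k : ℂ) + 1)⁻¹ := by
  simp only [harm_eq_sum, Finset.sum_range_succ]

theorem hasDerivAt_inv_prod_sub {ι : Type*} (s : Finset ι) (c : ι → ℂ) {a : ℂ}
    (h : ∀ i ∈ s, c i ≠ a) :
    HasDerivAt (fun α => (∏ i ∈ s, (c i - α))⁻¹)
      ((∏ i ∈ s, (c i - a))⁻¹ * ∑ i ∈ s, (c i - a)⁻¹) a := by
  classical
  induction s using Finset.induction_on with
  | empty => simpa using hasDerivAt_const a (1 : ℂ)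
  | insert i s hi ih =>
    have h1 : c i - a ≠ 0 := sub_ne_zero.2 (h i (Finset.mem_insert_self i s))
    have h2 := ((hasDerivAt_id a).const_sub (c i)).inv h1
    have h3 := h2.mul (ih fun j hj => h j (Finset.mem_insert_of_mem hj))
    simp only [Finset.prod_insert hi, Finset.sum_insert hi, mul_inv]
    refine h3.congr_deriv ?_
    simp only [id_eq, Pi.inv_apply]
    field_simp

theorem prod_range_sub_self (p : ℕ) :
    ∏ j ∈ Finset.range p, ((j : ℂ) - p) = (-1) ^ p * (p ! : ℂ) := by
  induction p with
  | zero => simp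
  | succ p ih =>
    rw [Finset.prod_range_succ', Nat.factorial_succ, pow_succ]
    push_cast
    simp only [add_sub_add_right_eq_sub, ih]
    ring

theorem sum_range_inv_sub_self (p : ℕ) :
    ∑ j ∈ Finset.range p, ((j : ℂ) - p)⁻¹ = -harm p := by
  induction p with
  | zero => simp [harm_zero]
  | succ p ih =>
    rw [Finset.sum_range_succ', harm_succ]
    push_cast
    simp only [add_sub_add_right_eq_sub, ih, zero_sub, inv_neg]
    ring

theorem prod_range_add_one_cast (e : ℕ) : ∏ i ∈ Finset.range e, ((i : ℂ) + 1) = (e ! : ℂ) := by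
  rw [← Finset.prod_range_add_one_eq_factorial]; push_cast; rfl

/-! ### The derivative tower ending in z^(−α) -/

/-- The exceptional points of the Barnes zeta functions are `1, …, d`. -/
def regularSet (d : ℕ) : Set ℂ := {α | ∀ j ∈ Finset.Icc 1 d, α ≠ (j : ℂ)}

theorem regularSet_eq_compl (d : ℕ) :
    regularSet d = ((fun j : ℕ => (j : ℂ)) '' Finset.Icc 1 d)ᶜ := by
  ext α
  simp only [regularSet, Set.mem_ofPred_eq, Set.mem_compl_iff, Set.mem_image, Finset.mem_coe,
    not_exists, not_and, ne_eq, eq_comm]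

theorem isOpen_regularSet (d : ℕ) : IsOpen (regularSet d) := by
  rw [regularSet_eq_compl]
  exact ((Finset.finite_toSet _).image _).isClosed.isOpen_compl

theorem eventually_mem_regularSet (d q : ℕ) : ∀ᶠ α in 𝓝[≠] (q : ℂ), α ∈ regularSet d := by
  have hf : ((fun j : ℕ => (j : ℂ)) '' (Finset.Icc 1 d) \ {(q : ℂ)}).Finite :=
    ((Finset.finite_toSet _).image _).subset Set.sdiff_subset
  have h6 : ∀ᶠ α in 𝓝 (q : ℂ), α ∉ ((fun j : ℕ => (j : ℂ)) '' (Finset.Icc 1 d) \ {(q : ℂ)}) :=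
    hf.isClosed.isOpen_compl.mem_nhds (by simp)
  filter_upwards [h6.filter_mono nhdsWithin_le_nhds, self_mem_nhdsWithin] with α h7 h8 j hj h9
  exact h7 ⟨⟨j, hj, h9.symm⟩, h8⟩

theorem mem_regularSet_of_lt {d : ℕ} {α : ℂ} (h : (d : ℝ) < α.re) : α ∈ regularSet d := by
  rintro j hj rfl
  rw [Complex.natCast_re, Nat.cast_lt] at h
  have := (Finset.mem_Icc.1 hj).2
  omega

theorem zero_mem_regularSet (d : ℕ) : (0 : ℂ) ∈ regularSet d := by
  intro j hj h
  have := (Finset.mem_Icc.1 hj).1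
  rw [eq_comm, Nat.cast_eq_zero] at h
  omega

theorem prod_add_one_sub_ne_zero {d : ℕ} {α : ℂ} (h : α ∈ regularSet d) {K : ℕ} (hK : K ≤ d) :
    ∏ j ∈ Finset.range K, ((j : ℂ) + 1 - α) ≠ 0 := by
  refine Finset.prod_ne_zero_iff.2 fun j hj h0 => ?_
  have := Finset.mem_range.1 hj
  refine h (j + 1) (Finset.mem_Icc.2 ⟨by omega, by omega⟩) ?_
  rw [sub_eq_zero] at h0
  rw [← h0]; push_cast; rfl

/-- The coefficient of the `k`-th derivative of `z ^ (d - α) / ((1 - α) ⋯ (d - α))`. -/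
noncomputable def zetaCoeff (d k : ℕ) (α : ℂ) : ℂ :=
  (∏ j ∈ Finset.range k, ((d : ℂ) - α - j)) / ∏ j ∈ Finset.range d, ((j : ℂ) + 1 - α)

theorem prod_range_sub_mul (e k : ℕ) (α : ℂ) :
    (∏ j ∈ Finset.range k, (((e + k : ℕ) : ℂ) - α - j)) *
      ∏ j ∈ Finset.range e, ((j : ℂ) + 1 - α) =
      ∏ j ∈ Finset.range (e + k), ((j : ℂ) + 1 - α) := by
  induction k with
  | zero => simp
  | succ k ih =>
    rw [Finset.prod_range_succ', ← add_assoc, Finset.prod_range_succ _ (e + k), ← ih]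
    have h : ∀ j ∈ Finset.range k, ((e + k + 1 : ℕ) : ℂ) - α - ((j + 1 : ℕ) : ℂ) =
        ((e + k : ℕ) : ℂ) - α - j := fun j _ => by push_cast; ring
    rw [Finset.prod_congr rfl h]
    push_cast
    ring

/-- The numerator cancels the last k factors of the denominator, so only the poles 1, …, d − k
remain. -/
theorem zetaCoeff_of_le {d k : ℕ} (hk : k ≤ d) {α : ℂ} (h : α ∈ regularSet d) :
    zetaCoeff d k α = (∏ j ∈ Finset.range (d - k), ((j : ℂ) + 1 - α))⁻¹ := by
  have h1 := prod_range_sub_mul (d - k) k α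
  rw [Nat.sub_add_cancel hk] at h1
  rw [zetaCoeff, div_eq_iff (prod_add_one_sub_ne_zero h le_rfl), ← h1, mul_comm (∏ j ∈ _, _),
    inv_mul_cancel_left₀ (prod_add_one_sub_ne_zero h (Nat.sub_le d k))]

/-- From the d-th derivative on no denominator is left, so the bounds on high derivatives stay
uniform as α approaches one of 1, …, d. -/
theorem zetaCoeff_add {d : ℕ} (k : ℕ) {α : ℂ} (h : α ∈ regularSet d) :
    zetaCoeff d (d + k) α = ∏ j ∈ Finset.range k, (-α - j) := by
  have h1 := zetaCoeff_of_le le_rfl h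
  rw [Nat.sub_self, Finset.prod_range_zero, inv_one] at h1
  rw [zetaCoeff, Finset.prod_range_add, mul_div_right_comm, ← zetaCoeff, h1, one_mul]
  refine Finset.prod_congr rfl fun j _ => ?_
  push_cast
  ring

theorem differentiableAt_zetaCoeff (d k : ℕ) {α : ℂ} (h : α ∈ regularSet d) :
    DifferentiableAt ℂ (zetaCoeff d k) α := by
  unfold zetaCoeff
  refine DifferentiableAt.div ?_ ?_ (prod_add_one_sub_ne_zero h le_rfl) <;> fun_prop

/-- The derivatives of `z ^ (d - α) / ((1 - α) ⋯ (d - α))`; the `d`-th one is `z ^ (-α)`. -/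
noncomputable def zetaTower (θ : ℝ) (d : ℕ) (α : ℂ) (k : ℕ) (z : ℂ) : ℂ :=
  zetaCoeff d k α * branchPow θ z (d - k - α)

theorem isDerivTower_zetaTower (θ : ℝ) (d : ℕ) (α : ℂ) :
    IsDerivTower (halfPlane θ) (zetaTower θ d α) := by
  intro k z hz
  refine ((hasDerivAt_branchPow hz ((d : ℂ) - k - α)).const_mul (zetaCoeff d k α)).congr_deriv ?_
  rw [zetaTower, zetaCoeff, zetaCoeff, Finset.prod_range_succ]
  push_cast
  rw [show (d : ℂ) - k - α - 1 = d - (k + 1) - α by ring]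
  ring

theorem zetaTower_self (θ : ℝ) {d : ℕ} {α : ℂ} (h : α ∈ regularSet d) (z : ℂ) :
    zetaTower θ d α d z = branchPow θ z (-α) := by
  have h1 := zetaCoeff_add 0 h
  rw [add_zero, Finset.prod_range_zero] at h1
  rw [zetaTower, h1, one_mul, sub_self, zero_sub]

theorem differentiableAt_zetaTower (θ : ℝ) (d k : ℕ) {α : ℂ} (h : α ∈ regularSet d) (z : ℂ) :
    DifferentiableAt ℂ (fun α => zetaTower θ d α k z) α := by
  unfold zetaTower
  refine (differentiableAt_zetaCoeff d k h).mul ?_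
  unfold branchPow
  fun_prop

theorem norm_zetaTower_le (θ : ℝ) (d k : ℕ) (α : ℂ) {z : ℂ} (hz : z ∈ halfPlane θ) :
    ‖zetaTower θ d α k z‖ ≤
      ‖zetaCoeff d k α‖ * Real.exp (|α.im| * (|θ| + Real.pi)) * ‖z‖ ^ (-(α.re + k - d)) := by
  rw [zetaTower, norm_mul, mul_assoc]
  refine mul_le_mul_of_nonneg_left ?_ (norm_nonneg _)
  refine (norm_branchPow_le (ne_zero_of_mem_halfPlane hz) _).trans (le_of_eq ?_)
  rw [mul_comm]
  congr 1
  · simp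
  · congr 1
    simp
    ring

/-- The centre α₀ may be one of the exceptional points; regularity is asked only of the nearby α.
This allows dominated convergence at the poles. -/
theorem exists_norm_zetaTower_le (θ : ℝ) (d N : ℕ) (α₀ : ℂ) {c σ : ℝ} (hc : 0 < c)
    (hσ : σ < α₀.re + N + 1) :
    ∃ K : ℝ, 0 ≤ K ∧ ∀ᶠ α in 𝓝 α₀, α ∈ regularSet d → ∀ z ∈ halfPlane θ, c ≤ ‖z‖ →
      ‖zetaTower θ d α (d + N + 1) z‖ ≤ K * ‖z‖ ^ (-σ) := by
  -- The power of c absorbs the surplus exponent Re α + N + 1 − σ > 0, using ‖z‖ ≥ c. Continuity of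
  -- this bound then gives the constant B α₀ + 1 near α₀.
  let B : ℂ → ℝ := fun α => ‖∏ j ∈ Finset.range (N + 1), (-α - j)‖ *
    Real.exp (|α.im| * (|θ| + Real.pi)) * c ^ (σ - (α.re + N + 1))
  have hB : Continuous B := by
    refine Continuous.mul (Continuous.mul ?_ ?_) ?_
    · fun_prop
    · fun_prop
    · exact Continuous.rpow continuous_const (by fun_prop) fun _ => Or.inl hc.ne'
  have hB0 : ∀ α, 0 ≤ B α := fun α => by positivity
  refine ⟨B α₀ + 1, add_nonneg (hB0 _) zero_le_one, ?_⟩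
  have h1 : ∀ᶠ α in 𝓝 α₀, B α < B α₀ + 1 := hB.continuousAt.eventually_lt_const (lt_add_one _)
  have h2 : ∀ᶠ α : ℂ in 𝓝 α₀, σ < α.re + N + 1 :=
    (show ContinuousAt (fun α : ℂ => α.re + N + 1) α₀ by fun_prop).eventually_const_lt hσ
  filter_upwards [h1, h2] with α h1 h2 hα z hz hcz
  refine (norm_zetaTower_le θ d _ α hz).trans ?_
  rw [add_assoc d, zetaCoeff_add _ hα]
  have hzp : 0 < ‖z‖ := hc.trans_le hcz
  have h3 : ‖z‖ ^ (-(α.re + ((d + (N + 1) : ℕ) : ℝ) - d)) ≤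
      c ^ (σ - (α.re + N + 1)) * ‖z‖ ^ (-σ) := by
    rw [show -(α.re + ((d + (N + 1) : ℕ) : ℝ) - d) = (σ - (α.re + N + 1)) + -σ by
      push_cast; ring, Real.rpow_add hzp]
    exact mul_le_mul_of_nonneg_right
      (Real.rpow_le_rpow_of_nonpos hc hcz (by linarith)) (Real.rpow_nonneg hzp.le _)
  refine (mul_le_mul_of_nonneg_left h3 (by positivity)).trans ?_
  rw [← mul_assoc]
  exact mul_le_mul_of_nonneg_right h1.le (Real.rpow_nonneg hzp.le _)

/-! ### The logarithmic tower and its relation to the power tower -/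

/-- The derivatives of `z ^ d (H_d - log z) / d!`; the `d`-th one is `-log z`. -/
noncomputable def logTower (θ : ℝ) (d k : ℕ) (z : ℂ) : ℂ :=
  if k ≤ d then z ^ (d - k) / ((d - k)! : ℂ) * (harm (d - k) - branchLog θ z)
  else (-1) ^ (k - d) * ((k - d - 1)! : ℂ) / z ^ (k - d)

theorem isDerivTower_logTower (θ : ℝ) (d : ℕ) :
    IsDerivTower (halfPlane θ) (logTower θ d) := by
  intro k z hz
  have hz0 := ne_zero_of_mem_halfPlane hz
  unfold logTower
  rcases lt_trichotomy k d with h | h | h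
  · obtain ⟨j, rfl⟩ : ∃ j, d = k + 1 + j := ⟨d - (k + 1), by omega⟩
    have e1 : k + 1 + j - k = j + 1 := by omega
    have e2 : k + 1 + j - (k + 1) = j := by omega
    simp only [if_pos h.le, if_pos (show k + 1 ≤ k + 1 + j by omega), e1, e2]
    have h1 := (((hasDerivAt_id z).pow (j + 1)).div_const ((j + 1)! : ℂ)).mul
      ((hasDerivAt_branchLog hz).const_sub (harm (j + 1)))
    refine h1.congr_deriv ?_
    have h2 : (j ! : ℂ) ≠ 0 := by exact_mod_cast Nat.factorial_ne_zero j
    have h3 : ((j : ℂ) + 1) ≠ 0 := by exact_mod_cast Nat.succ_ne_zero j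
    rw [Nat.factorial_succ, harm_succ]
    push_cast
    simp only [id_eq, Pi.pow_apply]
    field_simp
    ring
  · subst h
    simp only [le_refl, if_true, Nat.sub_self, if_neg (show ¬ k + 1 ≤ k by omega)]
    have h1 := (hasDerivAt_branchLog hz).const_sub (harm 0)
    simpa [neg_div] using h1
  · obtain ⟨j, rfl⟩ : ∃ j, k = d + 1 + j := ⟨k - (d + 1), by omega⟩
    simp only [if_neg (show ¬ d + 1 + j ≤ d by omega), if_neg (show ¬ d + 1 + j + 1 ≤ d by omega),
      show d + 1 + j - d = j + 1 by omega, show d + 1 + j + 1 - d = j + 2 by omega,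
      Nat.add_sub_cancel, show j + 2 - 1 = j + 1 by omega]
    have h1 := (((hasDerivAt_id z).pow (j + 1)).inv (pow_ne_zero _ hz0)).const_mul
      ((-1) ^ (j + 1) * (j ! : ℂ))
    refine h1.congr_deriv ?_
    rw [Nat.factorial_succ]
    push_cast
    simp only [id_eq, Pi.pow_apply]
    field_simp
    ring

theorem norm_logTower_le (θ : ℝ) (d : ℕ) {k : ℕ} (hk : d < k) (z : ℂ) :
    ‖logTower θ d k z‖ ≤ ((k - d - 1)! : ℝ) * ‖z‖ ^ (-((k - d : ℕ) : ℝ)) := by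
  rw [logTower, if_neg hk.not_ge, norm_div, norm_mul, norm_pow, norm_neg, norm_one, one_pow,
    one_mul, Complex.norm_natCast, norm_pow, Real.rpow_neg (norm_nonneg _), Real.rpow_natCast,
    div_eq_mul_inv]

/-- The logarithmic derivative at 0 of 1/((1−α)⋯(d−k−α)) is H_{d−k}, and that of z^(d−k−α) is −log
z. -/
theorem hasDerivAt_zetaTower_zero (θ : ℝ) {d k : ℕ} (hk : k ≤ d) {z : ℂ} (hz : z ≠ 0) :
    HasDerivAt (fun α => zetaTower θ d α k z) (logTower θ d k z) 0 := by
  have h1 := hasDerivAt_inv_prod_sub (Finset.range (d - k)) (fun j => (j : ℂ) + 1) (a := 0)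
    (fun j _ => by exact_mod_cast Nat.succ_ne_zero j)
  have h2 := (hasDerivAt_branchPow_exponent θ z ((d : ℂ) - k - 0)).comp (0 : ℂ)
    ((hasDerivAt_id (0 : ℂ)).const_sub ((d : ℂ) - k))
  have h3 := h1.mul h2
  have h4 : (fun α => zetaTower θ d α k z) =ᶠ[𝓝 0]
      (fun α => (∏ i ∈ Finset.range (d - k), ((i : ℂ) + 1 - α))⁻¹) *
        ((fun s => branchPow θ z s) ∘ fun α => (d : ℂ) - k - id α) := by
    filter_upwards [(isOpen_regularSet d).mem_nhds (zero_mem_regularSet d)] with α hα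
    rw [zetaTower, zetaCoeff_of_le hk hα]
    rfl
  refine (h3.congr_of_eventuallyEq h4).congr_deriv ?_
  have h5 : (d : ℂ) - k = ((d - k : ℕ) : ℂ) := by rw [Nat.cast_sub hk]
  simp only [sub_zero, h5, Function.comp_apply, branchPow_natCast hz,
    prod_range_add_one_cast, ← harm_eq_sum, logTower, if_pos hk]
  ring

/-- The singular part at `α = q` is a polynomial in `z`; its removal leaves a shifted
`logTower` in the limit. -/
theorem tendsto_zetaTower_sub (θ : ℝ) {d k p : ℕ} (hk : k + (p + 1) ≤ d) {z : ℂ} (hz : z ≠ 0) :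
    Tendsto (fun α => zetaTower θ d α k z - (-1) ^ (p + 1) / (p ! : ℂ) / (α - (p + 1 : ℕ)) *
        (z ^ (d - (p + 1) - k) / ((d - (p + 1) - k)! : ℂ)))
      (𝓝[≠] ((p + 1 : ℕ) : ℂ))
      (𝓝 ((-1) ^ (p + 1) / (p ! : ℂ) * (logTower θ d (p + 1 + k) z -
        harm p * (z ^ (d - (p + 1) - k) / ((d - (p + 1) - k)! : ℂ))))) := by
  obtain ⟨e, rfl⟩ : ∃ e, d = k + (p + 1) + e := ⟨d - (k + (p + 1)), by omega⟩
  have e1 : k + (p + 1) + e - (p + 1) - k = e := by omega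
  have e2 : k + (p + 1) + e - (p + 1 + k) = e := by omega
  have e3 : k + (p + 1) + e - k = p + 1 + e := by omega
  rw [e1]
  have hp0 : (p ! : ℂ) ≠ 0 := by exact_mod_cast Nat.factorial_ne_zero p
  have he0 : (e ! : ℂ) ≠ 0 := by exact_mod_cast Nat.factorial_ne_zero e
  have h1 := hasDerivAt_inv_prod_sub (Finset.range p) (fun j => (j : ℂ) + 1)
    (a := ((p + 1 : ℕ) : ℂ)) (fun j hj => by
      have := Finset.mem_range.1 hj
      exact_mod_cast (show j + 1 ≠ p + 1 by omega))
  have h2 := hasDerivAt_inv_prod_sub (Finset.range e) (fun j => ((p + 1 + j : ℕ) : ℂ) + 1)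
    (a := ((p + 1 : ℕ) : ℂ)) (fun j hj => by
      exact_mod_cast (show p + 1 + j + 1 ≠ p + 1 by omega))
  have h3 := (hasDerivAt_branchPow_exponent θ z
    (((k + (p + 1) + e : ℕ) : ℂ) - k - ((p + 1 : ℕ) : ℂ))).comp ((p + 1 : ℕ) : ℂ)
    ((hasDerivAt_id ((p + 1 : ℕ) : ℂ)).const_sub (((k + (p + 1) + e : ℕ) : ℂ) - k))
  -- Removing the factor p + 1 − α, which vanishes at p + 1, leaves a function g regular there, with
  -- the tower equal to g(α)/(α − p − 1) after the sign change. Subtracting the singular part gives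
  -- the slope of g, whose limit is g'(p + 1).
  have h4 := ((h1.mul h2).mul h3).neg.tendsto_slope
  have s1 : ∏ j ∈ Finset.range p, ((j : ℂ) + 1 - ((p + 1 : ℕ) : ℂ)) = (-1) ^ p * (p ! : ℂ) := by
    rw [← prod_range_sub_self]
    exact Finset.prod_congr rfl fun j _ => by push_cast; ring
  have s2 : ∑ j ∈ Finset.range p, ((j : ℂ) + 1 - ((p + 1 : ℕ) : ℂ))⁻¹ = -harm p := by
    rw [← sum_range_inv_sub_self]
    exact Finset.sum_congr rfl fun j _ => by push_cast; ring
  have s3 : ∏ j ∈ Finset.range e, (((p + 1 + j : ℕ) : ℂ) + 1 - ((p + 1 : ℕ) : ℂ)) = (e ! : ℂ) := by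
    rw [← prod_range_add_one_cast]
    exact Finset.prod_congr rfl fun j _ => by push_cast; ring
  have s4 : ∑ j ∈ Finset.range e, (((p + 1 + j : ℕ) : ℂ) + 1 - ((p + 1 : ℕ) : ℂ))⁻¹ = harm e := by
    rw [harm_eq_sum]
    exact Finset.sum_congr rfl fun j _ => by push_cast; ring
  have s5 : ((k + (p + 1) + e : ℕ) : ℂ) - k - ((p + 1 : ℕ) : ℂ) = (e : ℂ) := by
    push_cast; ring
  have hsgn : ((-1 : ℂ) ^ p)⁻¹ = (-1) ^ p := by rw [← inv_pow]; norm_num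
  refine (h4.congr' ?_).trans_eq ?_
  · filter_upwards [eventually_mem_regularSet (k + (p + 1) + e) (p + 1), self_mem_nhdsWithin] with α hα hne
    have hne' : α - ((p + 1 : ℕ) : ℂ) ≠ 0 := sub_ne_zero.2 hne
    have hne'' : ((p + 1 : ℕ) : ℂ) - α ≠ 0 := sub_ne_zero.2 (Ne.symm hne)
    rw [slope_def_field, zetaTower, zetaCoeff_of_le (by omega) hα, e3, Finset.prod_range_add,
      Finset.prod_range_succ]
    simp only [Pi.neg_apply, Pi.mul_apply, Function.comp_apply, s1, s3, s5,
      branchPow_natCast hz, mul_inv, hsgn]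
    have : ((p : ℂ) + 1 - α) = -(α - ((p + 1 : ℕ) : ℂ)) := by push_cast; ring
    rw [this, pow_succ]
    field_simp
  · congr 1
    simp only [Pi.mul_apply, Function.comp_apply, s1, s2, s3, s4, s5, logTower,
      branchPow_natCast hz, mul_inv, hsgn, e2, if_pos (show p + 1 + k ≤ k + (p + 1) + e by omega)]
    rw [pow_succ]
    field_simp
    ring

/-! ### Analytic continuation of the zeta functions -/

theorem exists_summable_regTerm_zetaTower {θ : ℝ} {d : ℕ} (hd : 0 < d) {w : Fin d → ℂ}
    (hw : ∀ i, w i ∈ halfPlane θ) {a : ℂ} (ha : a ∈ coneDomain θ w) {N : ℕ} {α₀ : ℂ}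
    (hN : (d : ℝ) < α₀.re + N + 1) :
    ∃ v : {n : Fin d → ℕ // n ≠ 0} → ℝ, Summable v ∧ ∀ᶠ α in 𝓝 α₀, α ∈ regularSet d →
      ∀ n, ‖regTerm w N (zetaTower θ d α) (a + dotW n.1 w)‖ ≤ v n := by
  obtain ⟨σ, h1, h2⟩ := exists_between hN
  obtain ⟨c, hc, δ, hδ, u, hu, -, -, hb⟩ := exists_summable_bound hd hw ha N h1
  obtain ⟨K, hK, hev⟩ := exists_norm_zetaTower_le θ d N α₀ hc h2
  refine ⟨fun n => K * u n, hu.mul_left K, ?_⟩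
  filter_upwards [hev] with α h hα n
  exact hb _ K hK (isDerivTower_zetaTower θ d α) (h hα) a (Metric.mem_ball_self hδ) n

theorem summable_regTerm_zetaTower {θ : ℝ} {d : ℕ} (hd : 0 < d) {w : Fin d → ℂ}
    (hw : ∀ i, w i ∈ halfPlane θ) {a : ℂ} (ha : a ∈ coneDomain θ w) {N : ℕ} {α : ℂ}
    (hα : α ∈ regularSet d) (hN : (d : ℝ) < α.re + N + 1) :
    Summable fun n : {n : Fin d → ℕ // n ≠ 0} =>
      regTerm w N (zetaTower θ d α) (a + dotW n.1 w) := by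
  obtain ⟨v, hv, h⟩ := exists_summable_regTerm_zetaTower hd hw ha hN
  exact Summable.of_norm_bounded hv (h.self_of_nhds hα)

theorem differentiableAt_regTerm_zetaTower (θ : ℝ) {d : ℕ} (w : Fin d → ℂ) (N : ℕ) (x : ℂ)
    {α : ℂ} (hα : α ∈ regularSet d) :
    DifferentiableAt ℂ (fun α => regTerm w N (zetaTower θ d α) x) α := by
  unfold regTerm
  refine (differentiableAt_zetaTower θ d d hα x).fun_sub (DifferentiableAt.fun_sum fun m _ => ?_)
  simp only [opG_eq_sum]
  exact (DifferentiableAt.fun_sum fun S _ =>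
    (differentiableAt_zetaTower θ d m hα _).const_mul _).const_mul _

/-- Weierstrass: a locally uniform summable majorant for holomorphic terms gives holomorphy of the
sum and termwise differentiation. -/
theorem regSum_zetaTower_aux {θ : ℝ} {d : ℕ} (hd : 0 < d) {w : Fin d → ℂ}
    (hw : ∀ i, w i ∈ halfPlane θ) {a : ℂ} (ha : a ∈ coneDomain θ w) {N : ℕ} {α₀ : ℂ}
    (hα : α₀ ∈ regularSet d) (hN : (d : ℝ) < α₀.re + N + 1) :
    DifferentiableAt ℂ (fun α => ∑' n : {n : Fin d → ℕ // n ≠ 0},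
      regTerm w N (zetaTower θ d α) (a + dotW n.1 w)) α₀ ∧
    deriv (fun α => ∑' n : {n : Fin d → ℕ // n ≠ 0},
      regTerm w N (zetaTower θ d α) (a + dotW n.1 w)) α₀ =
      ∑' n : {n : Fin d → ℕ // n ≠ 0},
        deriv (fun α => regTerm w N (zetaTower θ d α) (a + dotW n.1 w)) α₀ := by
  obtain ⟨v, hv, h⟩ := exists_summable_regTerm_zetaTower hd hw ha hN
  obtain ⟨V, hV, hVo, hmem⟩ := eventually_nhds_iff.1
    (h.and ((isOpen_regularSet d).mem_nhds hα))
  have h1 : ∀ n : {n : Fin d → ℕ // n ≠ 0}, DifferentiableOn ℂ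
      (fun α => regTerm w N (zetaTower θ d α) (a + dotW n.1 w)) V := fun n α hα' =>
    (differentiableAt_regTerm_zetaTower θ w N _ (hV α hα').2).differentiableWithinAt
  have h2 : ∀ (n : {n : Fin d → ℕ // n ≠ 0}) (α : ℂ), α ∈ V →
      ‖regTerm w N (zetaTower θ d α) (a + dotW n.1 w)‖ ≤ v n := fun n α hα' =>
    (hV α hα').1 (hV α hα').2 n
  exact ⟨(Complex.differentiableOn_tsum_of_summable_norm hv h1 hVo h2).differentiableAt
    (hVo.mem_nhds hmem), (Complex.hasSum_deriv_of_summable_norm hv h1 hVo h2 hmem).tsum_eq.symm⟩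

theorem differentiableAt_regSum_zetaTower {θ : ℝ} {d : ℕ} (hd : 0 < d) {w : Fin d → ℂ}
    (hw : ∀ i, w i ∈ halfPlane θ) {a : ℂ} (ha : a ∈ coneDomain θ w) {N : ℕ} {α₀ : ℂ}
    (hα : α₀ ∈ regularSet d) (hN : (d : ℝ) < α₀.re + N + 1) :
    DifferentiableAt ℂ (fun α => regSum w N (zetaTower θ d α) a) α₀ := by
  unfold regSum
  refine (DifferentiableAt.fun_neg (DifferentiableAt.fun_sum fun m _ => ?_)).fun_add
    (regSum_zetaTower_aux hd hw ha hα hN).1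
  unfold opF
  exact (DifferentiableAt.fun_sum fun S _ =>
    (differentiableAt_zetaTower θ d m hα _).const_mul _).const_mul _

theorem add_dotW_mem_halfPlane {θ : ℝ} {d : ℕ} {w : Fin d → ℂ} (hw : ∀ i, w i ∈ halfPlane θ)
    {a : ℂ} (ha : a ∈ coneDomain θ w) {n : Fin d → ℕ} (hn : n ≠ 0) :
    a + dotW n w ∈ halfPlane θ := by
  obtain ⟨c, hc, δ, hδ, hb⟩ := exists_height_bound hw ha
  have h := hb a (Metric.mem_ball_self hδ) n hn ∅ _ (left_mem_segment ℝ _ _)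
  refine lt_of_lt_of_le ?_ h
  have : 0 ≤ ∑ i, (n i : ℝ) := Finset.sum_nonneg fun _ _ => Nat.cast_nonneg _
  positivity

theorem add_sum_mem_halfPlane {θ : ℝ} {d : ℕ} {w : Fin d → ℂ} (hw : ∀ i, w i ∈ halfPlane θ)
    {x : ℂ} (hx : x ∈ halfPlane θ) (S : Finset (Fin d)) : x + ∑ i ∈ S, w i ∈ halfPlane θ := by
  rw [mem_halfPlane, height_add]
  exact add_pos_of_pos_of_nonneg hx (height_sum_nonneg hw S)

theorem add_sum_mem_halfPlane_of_nonempty {θ : ℝ} {d : ℕ} {w : Fin d → ℂ}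
    (hw : ∀ i, w i ∈ halfPlane θ) {a : ℂ} (ha : a ∈ coneDomain θ w) {S : Finset (Fin d)}
    (hS : S.Nonempty) : a + ∑ i ∈ S, w i ∈ halfPlane θ := by
  obtain ⟨i, hi⟩ := hS
  rw [← Finset.add_sum_erase _ _ hi, ← add_assoc]
  exact add_sum_mem_halfPlane hw (ha i) _

theorem hasDerivAt_regTerm_zetaTower_zero {θ : ℝ} {d : ℕ} {w : Fin d → ℂ}
    (hw : ∀ i, w i ∈ halfPlane θ) {x : ℂ} (hx : x ∈ halfPlane θ) :
    HasDerivAt (fun α => regTerm w d (zetaTower θ d α) x) (regTerm w d (logTower θ d) x) 0 := by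
  unfold regTerm
  refine (hasDerivAt_zetaTower_zero θ le_rfl (ne_zero_of_mem_halfPlane hx)).fun_sub
    (HasDerivAt.fun_sum fun m hm => ?_)
  simp only [opG_eq_sum]
  exact (HasDerivAt.fun_sum fun S _ => (hasDerivAt_zetaTower_zero θ
    (Nat.lt_succ_iff.1 (Finset.mem_range.1 hm))
    (ne_zero_of_mem_halfPlane (add_sum_mem_halfPlane hw hx S))).const_mul _).const_mul _

theorem hasDerivAt_regSum_zetaTower_zero {θ : ℝ} {d : ℕ} (hd : 0 < d) {w : Fin d → ℂ}
    (hw : ∀ i, w i ∈ halfPlane θ) {a : ℂ} (ha : a ∈ coneDomain θ w) :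
    HasDerivAt (fun α => regSum w d (zetaTower θ d α) a) (regSum w d (logTower θ d) a) 0 := by
  have hN : (d : ℝ) < (0 : ℂ).re + d + 1 := by simp
  obtain ⟨h1, h2⟩ := regSum_zetaTower_aux hd hw ha (zero_mem_regularSet d) hN
  have h3 := h1.hasDerivAt
  rw [h2, tsum_congr fun n : {n : Fin d → ℕ // n ≠ 0} => (hasDerivAt_regTerm_zetaTower_zero hw
    (add_dotW_mem_halfPlane hw ha n.2)).deriv] at h3
  unfold regSum
  refine (HasDerivAt.fun_neg (HasDerivAt.fun_sum fun m hm => ?_)).fun_add h3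
  unfold opF
  exact (HasDerivAt.fun_sum fun S hS => (hasDerivAt_zetaTower_zero θ
    (Nat.lt_succ_iff.1 (Finset.mem_range.1 hm)) (ne_zero_of_mem_halfPlane
      (add_sum_mem_halfPlane_of_nonempty hw ha (Finset.mem_filter.1 hS).2))).const_mul _).const_mul _

/-- The continuation of `α ↦ ∑_{n ≠ 0} (a + n · w)^{-α}`. -/
noncomputable def zetaCont (θ : ℝ) {d : ℕ} (w : Fin d → ℂ) (a α : ℂ) : ℂ :=
  regSum w (d + ⌈|α.re|⌉₊) (zetaTower θ d α) a

/-- The truncation order in `zetaCont` jumps with α. Any admissible order gives the same value,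
because the extra boundary terms decay; near a given point the order can thus be held fixed. -/
theorem zetaCont_eq {θ : ℝ} {d : ℕ} (hd : 0 < d) {w : Fin d → ℂ}
    (hw : ∀ i, w i ∈ halfPlane θ) {a : ℂ} (ha : a ∈ coneDomain θ w) {N : ℕ} {α : ℂ}
    (hα : α ∈ regularSet d) (hN : (d : ℝ) < α.re + N + 1) :
    zetaCont θ w a α = regSum w N (zetaTower θ d α) a := by
  have key : ∀ N N' : ℕ, (d : ℝ) < α.re + N + 1 → N ≤ N' →
      regSum w N' (zetaTower θ d α) a = regSum w N (zetaTower θ d α) a := by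
    intro N N' hN hle
    have hle' : (N : ℝ) ≤ N' := by exact_mod_cast hle
    refine regSum_eq_of_tendsto_zero w hle _ a (summable_regTerm_zetaTower hd hw ha hα hN)
      (summable_regTerm_zetaTower hd hw ha hα (by linarith)) fun m hm => ?_
    have hm' : (N : ℝ) + 1 ≤ m := by exact_mod_cast hm
    exact tendsto_opF_zero hw a (show (0 : ℝ) < α.re + m - d by linarith)
      fun z hz => norm_zetaTower_le θ d m α hz
  have h1 : (d : ℝ) < α.re + (d + ⌈|α.re|⌉₊ : ℕ) + 1 := by
    have := Nat.le_ceil |α.re|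
    have := neg_abs_le α.re
    push_cast
    linarith
  rw [zetaCont]
  rcases le_total N (d + ⌈|α.re|⌉₊) with h | h
  · exact key _ _ hN h
  · exact (key _ _ h1 h).symm

theorem zetaCont_eventuallyEq {θ : ℝ} {d : ℕ} (hd : 0 < d) {w : Fin d → ℂ}
    (hw : ∀ i, w i ∈ halfPlane θ) {a : ℂ} (ha : a ∈ coneDomain θ w) {N : ℕ} {α₀ : ℂ}
    (hN : (d : ℝ) < α₀.re + N + 1) :
    ∀ᶠ α in 𝓝 α₀, α ∈ regularSet d → zetaCont θ w a α = regSum w N (zetaTower θ d α) a := by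
  have h2 : ∀ᶠ α : ℂ in 𝓝 α₀, (d : ℝ) < α.re + N + 1 :=
    (show ContinuousAt (fun α : ℂ => α.re + N + 1) α₀ by fun_prop).eventually_const_lt hN
  filter_upwards [h2] with α h hα
  exact zetaCont_eq hd hw ha hα h

theorem differentiableOn_zetaCont {θ : ℝ} {d : ℕ} (hd : 0 < d) {w : Fin d → ℂ}
    (hw : ∀ i, w i ∈ halfPlane θ) {a : ℂ} (ha : a ∈ coneDomain θ w) :
    DifferentiableOn ℂ (zetaCont θ w a) (regularSet d) := by
  intro α₀ hα
  have hN : (d : ℝ) < α₀.re + (d + ⌈|α₀.re|⌉₊ : ℕ) + 1 := by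
    have := Nat.le_ceil |α₀.re|
    have := neg_abs_le α₀.re
    push_cast
    linarith
  refine DifferentiableAt.differentiableWithinAt ?_
  refine (differentiableAt_regSum_zetaTower hd hw ha hα hN).congr_of_eventuallyEq ?_
  filter_upwards [zetaCont_eventuallyEq hd hw ha hN, (isOpen_regularSet d).mem_nhds hα] with α h h'
  exact h h'

/-- For Re α > d even the boundary term with m = 0 tends to 0, so order N = 0 suffices and the
regularised sum is the limit of the plain cube sums. -/
theorem hasSum_zetaCont {θ : ℝ} {d : ℕ} (hd : 0 < d) {w : Fin d → ℂ}
    (hw : ∀ i, w i ∈ halfPlane θ) {a : ℂ} (ha : a ∈ coneDomain θ w) {α : ℂ}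
    (hα : (d : ℝ) < α.re) :
    HasSum (fun n : {n : Fin d → ℕ // n ≠ 0} => branchPow θ (a + dotW n.1 w) (-α))
      (zetaCont θ w a α) := by
  have hreg := mem_regularSet_of_lt hα
  obtain ⟨c, hc, δ, hδ, u, hu, -, hb, -⟩ := exists_summable_bound hd hw ha 0 hα
  have hs : Summable fun n : {n : Fin d → ℕ // n ≠ 0} =>
      branchPow θ (a + dotW n.1 w) (-α) := by
    refine Summable.of_norm_bounded (hu.mul_right (Real.exp (|(-α).im| * (|θ| + Real.pi))))
      fun n => ?_
    obtain ⟨h1, h2⟩ := hb a (Metric.mem_ball_self hδ) n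
    refine (norm_branchPow_le (ne_zero_of_mem_halfPlane h1) _).trans ?_
    exact mul_le_mul_of_nonneg_right h2 (Real.exp_nonneg _)
  have hN : (d : ℝ) < α.re + (0 : ℕ) + 1 := by push_cast; linarith
  have h1 := tendsto_regSum w 0 (zetaTower θ d α) a
    (summable_regTerm_zetaTower hd hw ha hreg hN)
  have h2 : Tendsto (fun M : ℕ => ∑ m ∈ Finset.range (0 + 1),
      toddCoeff w m * opF w (fun y => zetaTower θ d α m (a + M * y))) atTop (𝓝 0) := by
    have := tendsto_finsetSum (Finset.range (0 + 1)) fun m _ =>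
      (tendsto_opF_zero hw a (show (0 : ℝ) < α.re + m - d by
        have : (0 : ℝ) ≤ m := Nat.cast_nonneg m
        linarith) fun z hz => norm_zetaTower_le θ d m α hz).const_mul (toddCoeff w m)
    simpa using this
  have h3 := h1.add h2
  simp only [sub_add_cancel, zetaTower_self θ hreg, add_zero] at h3
  have h4 := tendsto_sum_puncturedCube (f := fun n => branchPow θ (a + dotW n w) (-α)) hs.hasSum
  rw [zetaCont_eq hd hw ha hreg hN, tendsto_nhds_unique h3 h4]
  exact hs.hasSum

theorem isHomBarnesZeta_zetaCont {θ : ℝ} {d : ℕ} (hd : 0 < d) {w : Fin d → ℂ}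
    (hw : ∀ i, w i ∈ halfPlane θ) : IsHomBarnesZeta θ w (zetaCont θ w 0) := by
  refine ⟨differentiableOn_zetaCont hd hw (zero_mem_coneDomain hw), fun α hα => ?_⟩
  have := hasSum_zetaCont hd hw (zero_mem_coneDomain hw) hα
  simpa only [zero_add] using this

/-- The term n = 0 is split off, since it alone is singular as a → 0; `zetaCont` makes sense for
apices around 0. -/
theorem isBarnesZeta_zetaCont {θ : ℝ} {d : ℕ} (hd : 0 < d) {w : Fin d → ℂ}
    (hw : ∀ i, w i ∈ halfPlane θ) {a : ℂ} (ha : a ∈ halfPlane θ) :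
    IsBarnesZeta θ w a (fun α => branchPow θ a (-α) + zetaCont θ w a α) := by
  have ha' := halfPlane_subset_coneDomain hw ha
  refine ⟨DifferentiableOn.add ?_ (differentiableOn_zetaCont hd hw ha'), fun α hα => ?_⟩
  · unfold branchPow
    fun_prop
  · have h1 := hasSum_zetaCont hd hw ha' hα
    have h2 : HasSum (fun n : ({0} : Set (Fin d → ℕ)) => branchPow θ (a + dotW n.1 w) (-α))
        (branchPow θ a (-α)) := by
      have := hasSum_unique (fun n : ({0} : Set (Fin d → ℕ)) => branchPow θ (a + dotW n.1 w) (-α))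
      simpa [dotW] using this
    exact HasSum.add_compl (s := {0}) h2 h1

/-- Identity theorem: the plane minus finitely many points is connected, and the half-plane Re α > d
is open. -/
theorem eqOn_regularSet {d : ℕ} {Z Z' : ℂ → ℂ} (h : DifferentiableOn ℂ Z (regularSet d))
    (h' : DifferentiableOn ℂ Z' (regularSet d)) (heq : ∀ α : ℂ, (d : ℝ) < α.re → Z α = Z' α) :
    Set.EqOn Z Z' (regularSet d) := by
  have hpre : IsPreconnected (regularSet d) := by
    rw [regularSet_eq_compl]
    exact (((Finset.finite_toSet _).image _).countable.isPathConnected_compl_of_one_lt_rank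
      (by rw [Complex.rank_real_complex]; exact Nat.one_lt_ofNat)).isConnected.isPreconnected
  have hmem : (d : ℝ) < ((d : ℂ) + 1).re := by simp
  refine (h.analyticOnNhd (isOpen_regularSet d)).eqOn_of_preconnected_of_eventuallyEq
    (h'.analyticOnNhd (isOpen_regularSet d)) hpre (mem_regularSet_of_lt hmem) ?_
  filter_upwards [Complex.continuous_re.continuousAt.eventually_const_lt hmem] with α hα
  exact heq α hα

theorem isHomBarnesZeta_homBarnesZeta {θ : ℝ} {d : ℕ} (hd : 0 < d) {w : Fin d → ℂ}
    (hw : ∀ i, w i ∈ halfPlane θ) : IsHomBarnesZeta θ w (homBarnesZeta θ w) := by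
  have h : ∃ Z, IsHomBarnesZeta θ w Z := ⟨_, isHomBarnesZeta_zetaCont hd hw⟩
  rw [homBarnesZeta, dif_pos h]
  exact h.choose_spec

theorem isBarnesZeta_barnesZeta {θ : ℝ} {d : ℕ} (hd : 0 < d) {w : Fin d → ℂ}
    (hw : ∀ i, w i ∈ halfPlane θ) {a : ℂ} (ha : a ∈ halfPlane θ) :
    IsBarnesZeta θ w a (barnesZeta θ w a) := by
  have h : ∃ Z, IsBarnesZeta θ w a Z := ⟨_, isBarnesZeta_zetaCont hd hw ha⟩
  rw [barnesZeta, dif_pos h]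
  exact h.choose_spec

theorem homBarnesZeta_eq {θ : ℝ} {d : ℕ} (hd : 0 < d) {w : Fin d → ℂ}
    (hw : ∀ i, w i ∈ halfPlane θ) : Set.EqOn (homBarnesZeta θ w) (zetaCont θ w 0) (regularSet d) :=
  eqOn_regularSet (isHomBarnesZeta_homBarnesZeta hd hw).1 (isHomBarnesZeta_zetaCont hd hw).1
    fun α hα => ((isHomBarnesZeta_homBarnesZeta hd hw).2 α hα).unique
      ((isHomBarnesZeta_zetaCont hd hw).2 α hα)

theorem barnesZeta_eq {θ : ℝ} {d : ℕ} (hd : 0 < d) {w : Fin d → ℂ}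
    (hw : ∀ i, w i ∈ halfPlane θ) {a : ℂ} (ha : a ∈ halfPlane θ) :
    Set.EqOn (barnesZeta θ w a) (fun α => branchPow θ a (-α) + zetaCont θ w a α)
      (regularSet d) :=
  eqOn_regularSet (isBarnesZeta_barnesZeta hd hw ha).1 (isBarnesZeta_zetaCont hd hw ha).1
    fun α hα => ((isBarnesZeta_barnesZeta hd hw ha).2 α hα).unique
      ((isBarnesZeta_zetaCont hd hw ha).2 α hα)

/-! ### Derivatives at α = 0, log Γ_B and the gamma modular forms -/

theorem hasDerivAt_zetaCont_zero {θ : ℝ} {d : ℕ} (hd : 0 < d) {w : Fin d → ℂ}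
    (hw : ∀ i, w i ∈ halfPlane θ) {a : ℂ} (ha : a ∈ coneDomain θ w) :
    HasDerivAt (zetaCont θ w a) (regSum w d (logTower θ d) a) 0 := by
  refine (hasDerivAt_regSum_zetaTower_zero hd hw ha).congr_of_eventuallyEq ?_
  filter_upwards [zetaCont_eventuallyEq hd hw ha (N := d) (α₀ := 0) (by simp),
    (isOpen_regularSet d).mem_nhds (zero_mem_regularSet d)] with α h h'
  exact h h'

theorem deriv_homBarnesZeta_zero {θ : ℝ} {d : ℕ} (hd : 0 < d) {w : Fin d → ℂ}
    (hw : ∀ i, w i ∈ halfPlane θ) :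
    deriv (homBarnesZeta θ w) 0 = regSum w d (logTower θ d) 0 :=
  ((hasDerivAt_zetaCont_zero hd hw (zero_mem_coneDomain hw)).congr_of_eventuallyEq
    ((homBarnesZeta_eq hd hw).eventuallyEq_of_mem
      ((isOpen_regularSet d).mem_nhds (zero_mem_regularSet d)))).deriv

theorem deriv_barnesZeta_zero {θ : ℝ} {d : ℕ} (hd : 0 < d) {w : Fin d → ℂ}
    (hw : ∀ i, w i ∈ halfPlane θ) {a : ℂ} (ha : a ∈ halfPlane θ) :
    deriv (barnesZeta θ w a) 0 = regSum w d (logTower θ d) a - branchLog θ a := by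
  have h1 := (hasDerivAt_branchPow_exponent θ a (-0)).comp (0 : ℂ) (hasDerivAt_id (0 : ℂ)).fun_neg
  have h2 := h1.add (hasDerivAt_zetaCont_zero hd hw (halfPlane_subset_coneDomain hw ha))
  refine (h2.congr_of_eventuallyEq ((barnesZeta_eq hd hw ha).eventuallyEq_of_mem
    ((isOpen_regularSet d).mem_nhds (zero_mem_regularSet d)))).deriv.trans ?_
  simp [branchPow]
  ring

theorem summable_regTerm_logTower_aux {θ : ℝ} {d : ℕ} (hd : 0 < d) {w : Fin d → ℂ}
    (hw : ∀ i, w i ∈ halfPlane θ) {a : ℂ} (ha : a ∈ coneDomain θ w) {N p : ℕ} (hp : d ≤ p + N) :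
    ∃ δ > 0, Metric.ball a δ ⊆ coneDomain θ w ∧
      ∃ v : {n : Fin d → ℕ // n ≠ 0} → ℝ, Summable v ∧ ∀ a' ∈ Metric.ball a δ, ∀ n,
      ‖regTerm w N (fun k => logTower θ d (p + k)) (a' + dotW n.1 w)‖ ≤ v n := by
  obtain ⟨c, hc, δ, hδ, u, hu, hsub, -, hb⟩ := exists_summable_bound hd hw ha N
    (σ := ((p + (d + N + 1) - d : ℕ) : ℝ)) (by exact_mod_cast (show d < p + (d + N + 1) - d by omega))
  refine ⟨δ, hδ, hsub, _, hu.mul_left ((p + (d + N + 1) - d - 1)! : ℝ), fun a' ha' n =>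
    hb _ _ (Nat.cast_nonneg _) (fun k => ?_) (fun z _ _ => ?_) a' ha' n⟩
  · exact isDerivTower_logTower θ d (p + k)
  · exact norm_logTower_le θ d (show d < p + (d + N + 1) by omega) z

theorem summable_regTerm_logTower {θ : ℝ} {d : ℕ} (hd : 0 < d) {w : Fin d → ℂ}
    (hw : ∀ i, w i ∈ halfPlane θ) {a : ℂ} (ha : a ∈ coneDomain θ w) {N p : ℕ} (hp : d ≤ p + N) :
    Summable fun n : {n : Fin d → ℕ // n ≠ 0} =>
      regTerm w N (fun k => logTower θ d (p + k)) (a + dotW n.1 w) := by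
  obtain ⟨δ, hδ, -, v, hv, h⟩ := summable_regTerm_logTower_aux hd hw ha hp
  exact Summable.of_norm_bounded hv (h a (Metric.mem_ball_self hδ))

theorem IsDerivTower.hasDerivAt_regTerm {θ : ℝ} {d : ℕ} {w : Fin d → ℂ}
    (hw : ∀ i, w i ∈ halfPlane θ) (N : ℕ) {f : ℕ → ℂ → ℂ} (hf : IsDerivTower (halfPlane θ) f)
    {x : ℂ} (hx : x ∈ halfPlane θ) :
    HasDerivAt (regTerm w N f) (regTerm w N (fun k => f (k + 1)) x) x := by
  unfold regTerm
  refine (hf d x hx).fun_sub (HasDerivAt.fun_sum fun m hm => ?_)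
  simp only [opG_eq_sum]
  exact (HasDerivAt.fun_sum fun S _ =>
    ((hf m _ (add_sum_mem_halfPlane hw hx S)).comp_add_const _ _).const_mul _).const_mul _

/-- Differentiation in the apex shifts the tower by one. It is valid on a full neighbourhood of 0,
which makes the limits a → 0 defining ρ_B and γ_{dq} plain continuity statements. -/
theorem hasDerivAt_regSum_logTower {θ : ℝ} {d : ℕ} (hd : 0 < d) {w : Fin d → ℂ}
    (hw : ∀ i, w i ∈ halfPlane θ) {a : ℂ} (ha : a ∈ coneDomain θ w) {N p : ℕ} (hp : d ≤ p + N) :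
    HasDerivAt (regSum w N (fun k => logTower θ d (p + k)))
      (regSum w N (fun k => logTower θ d (p + 1 + k)) a) a := by
  obtain ⟨δ, hδ, hsub, v, hv, h⟩ := summable_regTerm_logTower_aux hd hw ha
    (show d ≤ p + 1 + N by omega)
  have htower : IsDerivTower (halfPlane θ) (fun k => logTower θ d (p + k)) :=
    fun k => isDerivTower_logTower θ d (p + k)
  have hshift : (fun k => logTower θ d (p + (k + 1))) = fun k => logTower θ d (p + 1 + k) := by
    funext k
    rw [add_assoc, add_comm 1 k]
  have h1 := hasDerivAt_tsum_of_isPreconnected hv Metric.isOpen_ball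
    (convex_ball a δ).isPreconnected (g := fun (n : {n : Fin d → ℕ // n ≠ 0}) a =>
      regTerm w N (fun k => logTower θ d (p + k)) (a + dotW n.1 w))
    (g' := fun n a => regTerm w N (fun k => logTower θ d (p + 1 + k)) (a + dotW n.1 w))
    (fun n y hy => by
      have := (htower.hasDerivAt_regTerm hw N
        (add_dotW_mem_halfPlane hw (hsub hy) n.2)).comp_add_const _ _
      simpa only [hshift] using this)
    (fun n y hy => h y hy n) (Metric.mem_ball_self hδ)
    (summable_regTerm_logTower hd hw ha hp) (Metric.mem_ball_self hδ)
  unfold regSum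
  refine (HasDerivAt.fun_neg (HasDerivAt.fun_sum fun m _ => ?_)).fun_add h1
  unfold opF
  refine (HasDerivAt.fun_sum fun S hS => ?_).const_mul _
  have := (htower m _ (add_sum_mem_halfPlane_of_nonempty hw ha
    (Finset.mem_filter.1 hS).2)).comp_add_const _ _
  simp only [show p + 1 + m = p + (m + 1) by omega]
  exact this.const_mul _

/-- In the tower shifted by q, the members with m > d − q are negative powers of z, so the
corresponding boundary terms tend to 0. -/
theorem regSum_logTower_eq {θ : ℝ} {d : ℕ} (hd : 0 < d) {w : Fin d → ℂ}
    (hw : ∀ i, w i ∈ halfPlane θ) {a : ℂ} (ha : a ∈ coneDomain θ w) (q : ℕ) :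
    regSum w d (fun k => logTower θ d (q + k)) a =
      regSum w (d - q) (fun k => logTower θ d (q + k)) a := by
  refine regSum_eq_of_tendsto_zero w (Nat.sub_le d q) _ a
    (summable_regTerm_logTower hd hw ha (by omega))
    (summable_regTerm_logTower hd hw ha (by omega)) fun m hm => ?_
  exact tendsto_opF_zero hw a (by exact_mod_cast (show 0 < q + m - d by omega))
    fun z _ => norm_logTower_le θ d (show d < q + m by omega) z

theorem logGammaB_eq {θ : ℝ} {d : ℕ} (hd : 0 < d) {w : Fin d → ℂ}
    (hw : ∀ i, w i ∈ halfPlane θ) {a : ℂ} (ha : a ∈ halfPlane θ) :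
    logGammaB θ w a = -branchLog θ a + regSum w d (logTower θ d) a + logRho θ w := by
  rw [logGammaB, deriv_barnesZeta_zero hd hw ha]
  ring

theorem logTower_self (θ : ℝ) (d : ℕ) : logTower θ d d = fun z => -branchLog θ z := by
  funext z
  simp [logTower, harm_zero]

theorem differentiableOn_logGammaB {θ : ℝ} {d : ℕ} (hd : 0 < d) {w : Fin d → ℂ}
    (hw : ∀ i, w i ∈ halfPlane θ) : DifferentiableOn ℂ (logGammaB θ w) (halfPlane θ) := by
  intro a ha
  have h := hasDerivAt_regSum_logTower hd hw (halfPlane_subset_coneDomain hw ha)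
    (N := d) (p := 0) (by omega)
  simp only [zero_add] at h
  refine DifferentiableWithinAt.congr (((hasDerivAt_branchLog ha).neg.add h).add_const
    (logRho θ w)).differentiableAt.differentiableWithinAt (fun x hx => ?_) ?_
  · exact logGammaB_eq hd hw hx
  · exact logGammaB_eq hd hw ha

/-- The first summand comes from n = 0 and carries the whole singularity at a = 0; for q > 0 it
equals the term (−1)^q (q−1)!/a^q subtracted off in γ_{dq}. -/
theorem iteratedDeriv_logGammaB {θ : ℝ} {d : ℕ} (hd : 0 < d) {w : Fin d → ℂ}
    (hw : ∀ i, w i ∈ halfPlane θ) (q : ℕ) {a : ℂ} (ha : a ∈ halfPlane θ) :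
    iteratedDeriv q (logGammaB θ w) a = logTower θ d (d + q) a +
      regSum w d (fun k => logTower θ d (q + k)) a + if q = 0 then logRho θ w else 0 := by
  induction q generalizing a with
  | zero =>
    rw [iteratedDeriv_zero, logGammaB_eq hd hw ha, add_zero, logTower_self]
    simp only [zero_add, if_true]
  | succ q ih =>
    rw [iteratedDeriv_succ]
    have h1 : iteratedDeriv q (logGammaB θ w) =ᶠ[𝓝 a] fun a => logTower θ d (d + q) a +
        regSum w d (fun k => logTower θ d (q + k)) a + if q = 0 then logRho θ w else 0 := by
      filter_upwards [(isOpen_halfPlane θ).mem_nhds ha] with b hb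
      exact ih hb
    have h2 := ((isDerivTower_logTower θ d (d + q) a ha).fun_add (hasDerivAt_regSum_logTower hd hw
      (halfPlane_subset_coneDomain hw ha) (N := d) (p := q) (by omega))).add_const
        (if q = 0 then logRho θ w else 0)
    rw [(h2.congr_of_eventuallyEq h1).deriv, if_neg (Nat.succ_ne_zero q), add_zero, add_assoc d q]

theorem neBot_nhdsWithin_halfPlane {θ : ℝ} {x : ℂ} (hx : x ∈ halfPlane θ) :
    (𝓝[halfPlane θ] (0 : ℂ)).NeBot := by
  rw [← mem_closure_iff_nhdsWithin_neBot]
  have h : Tendsto (fun n : ℕ => (((n : ℝ) + 1)⁻¹ : ℝ) * x) atTop (𝓝 0) := by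
    have h1 : Tendsto (fun n : ℕ => (((n : ℝ) + 1)⁻¹ : ℝ)) atTop (𝓝 0) := by
      simpa [one_div] using tendsto_one_div_add_atTop_nhds_zero_nat (𝕜 := ℝ)
    have h2 := ((Complex.continuous_ofReal.tendsto 0).comp h1).mul_const x
    simpa using h2
  refine mem_closure_of_tendsto h (Eventually.of_forall fun n => ?_)
  rw [mem_halfPlane, height_real_mul]
  have : 0 < height θ x := hx
  positivity

theorem tendsto_regSum_logTower_halfPlane {θ : ℝ} {d : ℕ} (hd : 0 < d) {w : Fin d → ℂ}
    (hw : ∀ i, w i ∈ halfPlane θ) (q : ℕ) :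
    Tendsto (regSum w d (fun k => logTower θ d (q + k))) (𝓝[halfPlane θ] 0)
      (𝓝 (regSum w d (fun k => logTower θ d (q + k)) 0)) :=
  (hasDerivAt_regSum_logTower hd hw (zero_mem_coneDomain hw) (N := d) (p := q)
    (by omega)).continuousAt.tendsto.mono_left nhdsWithin_le_nhds

theorem tendsto_deriv_barnesZeta_add_log {θ : ℝ} {d : ℕ} (hd : 0 < d) {w : Fin d → ℂ}
    (hw : ∀ i, w i ∈ halfPlane θ) :
    Tendsto (fun a => deriv (barnesZeta θ w a) 0 + branchLog θ a) (𝓝[halfPlane θ] 0)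
      (𝓝 (regSum w d (logTower θ d) 0)) := by
  have h := tendsto_regSum_logTower_halfPlane hd hw 0
  simp only [zero_add] at h
  refine h.congr' ?_
  filter_upwards [self_mem_nhdsWithin] with a ha
  rw [deriv_barnesZeta_zero hd hw ha]
  ring

theorem neg_logRho_eq {θ : ℝ} {d : ℕ} (hd : 0 < d) {w : Fin d → ℂ}
    (hw : ∀ i, w i ∈ halfPlane θ) : -logRho θ w = regSum w d (logTower θ d) 0 := by
  have := neBot_nhdsWithin_halfPlane (hw ⟨0, hd⟩)
  rw [logRho, neg_neg, (tendsto_deriv_barnesZeta_add_log hd hw).limUnder_eq]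

theorem logTower_add (θ : ℝ) (d : ℕ) {q : ℕ} (hq : 0 < q) (z : ℂ) :
    logTower θ d (d + q) z = (-1) ^ q * ((q - 1)! : ℂ) / z ^ q := by
  rw [logTower, if_neg (by omega), Nat.add_sub_cancel_left]

theorem tendsto_gammaModularAux {θ : ℝ} {d : ℕ} (hd : 0 < d) {w : Fin d → ℂ}
    (hw : ∀ i, w i ∈ halfPlane θ) {q : ℕ} (hq : 0 < q) :
    Tendsto (gammaModularAux θ w q) (𝓝[halfPlane θ] 0)
      (𝓝 (-regSum w d (fun k => logTower θ d (q + k)) 0)) := by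
  refine (tendsto_regSum_logTower_halfPlane hd hw q).neg.congr' ?_
  filter_upwards [self_mem_nhdsWithin] with a ha
  rw [gammaModularAux, psiB, iteratedDeriv_logGammaB hd hw q ha, logTower_add θ d hq,
    if_neg hq.ne']
  ring

theorem gammaModular_eq {θ : ℝ} {d : ℕ} (hd : 0 < d) {w : Fin d → ℂ}
    (hw : ∀ i, w i ∈ halfPlane θ) {q : ℕ} (hq : 0 < q) :
    gammaModular θ w q = -regSum w (d - q) (fun k => logTower θ d (q + k)) 0 := by
  have := neBot_nhdsWithin_halfPlane (hw ⟨0, hd⟩)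
  rw [gammaModular, (tendsto_gammaModularAux hd hw hq).limUnder_eq,
    regSum_logTower_eq hd hw (zero_mem_coneDomain hw)]

/-! ### Explicit form of the logarithmic regularised sums -/

theorem opF_congr {θ : ℝ} {d : ℕ} {w : Fin d → ℂ} (hw : ∀ i, w i ∈ halfPlane θ) {f g : ℂ → ℂ}
    (h : ∀ x ∈ halfPlane θ, f x = g x) : opF w f = opF w g :=
  Finset.sum_congr rfl fun S hS => by
    rw [h _ (sum_mem_halfPlane hw (Finset.mem_filter.1 hS).2)]

/-- Of the powers of degree d − q − m, F keeps only degree 0, that is m = d − q, and degree d, that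
is q = m = 0. -/
theorem sum_range_ite_boundary {d q : ℕ} (hd : 0 < d) (hq : q ≤ d) (c : ℕ → ℂ) (A B : ℂ) :
    ∑ m ∈ Finset.range (d - q + 1), c m *
      (if d - q - m = 0 then A else if d - q - m = d then B else 0) =
      c (d - q) * A + if q = 0 then c 0 * B else 0 := by
  rw [Finset.sum_range_succ, Nat.sub_self, if_pos rfl, add_comm]
  congr 1
  split_ifs with h
  · subst h
    rw [Finset.sum_eq_single 0]
    · simp [hd.ne']
    · intro m hm hm0
      rw [Finset.mem_range] at hm
      rw [if_neg (by omega), if_neg (by omega), mul_zero]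
    · intro h; exact absurd (Finset.mem_range.2 (by omega)) h
  · refine Finset.sum_eq_zero fun m hm => ?_
    rw [Finset.mem_range] at hm
    rw [if_neg (by omega), if_neg (by omega), mul_zero]

theorem coeffS_div (c : ℕ) {d : ℕ} (w : Fin d → ℂ) (m : ℕ) :
    coeffS w m / ((m ! : ℂ) * (c ! : ℂ)) = toddCoeff w m / (c ! : ℂ) := by
  rw [toddCoeff, div_div]

/-- The harmonic numbers multiply pure powers of degree at most d. G kills these except in degree d,
which occurs only for q = m = 0 and leaves H_d. -/
theorem regTerm_logTower {θ : ℝ} {d : ℕ} (hd : 0 < d) {w : Fin d → ℂ}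
    (hw : ∀ i, w i ∈ halfPlane θ) {q : ℕ} (hq : q ≤ d) (x : ℂ) :
    regTerm w (d - q) (fun k => logTower θ d (q + k)) x =
      logTower θ d (d + q) x - (if q = 0 then harm d else 0) +
      ∑ m ∈ Finset.range (d - q + 1), coeffS w m / ((m ! : ℂ) * ((d - q - m)! : ℂ)) *
        opG w (fun y => (x + y) ^ (d - q - m) * branchLog θ (x + y)) := by
  have h : ∀ m ∈ Finset.range (d - q + 1), toddCoeff w m *
      opG w (fun y => logTower θ d (q + m) (x + y)) =
      (toddCoeff w m * harm (d - q - m)) * (if d - q - m = 0 then (0 : ℂ) else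
        if d - q - m = d then diffCoeff w d else 0) -
      coeffS w m / ((m ! : ℂ) * ((d - q - m)! : ℂ)) *
        opG w (fun y => (x + y) ^ (d - q - m) * branchLog θ (x + y)) := by
    intro m hm
    rw [Finset.mem_range] at hm
    have h1 : (fun y => logTower θ d (q + m) (x + y)) = fun y =>
        harm (d - q - m) * ((x + y) ^ (d - q - m) / ((d - q - m)! : ℂ)) -
        1 / ((d - q - m)! : ℂ) * ((x + y) ^ (d - q - m) * branchLog θ (x + y)) := by
      funext y
      rw [logTower, if_pos (by omega), ← Nat.sub_sub]
      ring
    rw [h1, opG_sub, opG_const_mul, opG_const_mul, opG_add_pow w x (by omega), coeffS_div]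
    split_ifs with h2 h3
    · omega
    · ring
    · ring
    · ring
  rw [regTerm, Finset.sum_congr rfl h, Finset.sum_sub_distrib,
    sum_range_ite_boundary hd hq (fun m => toddCoeff w m * harm (d - q - m)), add_comm q d]
  split_ifs with h0
  · subst h0
    have := toddCoeff_zero_mul_diffCoeff hd w fun i => ne_zero_of_mem_halfPlane (hw i)
    simp only [Nat.sub_zero]
    linear_combination (-harm d) * this
  · ring

/-- Since log(My) = log M + log y, the log M and harmonic parts multiply pure powers, and `opF_pow`
leaves only degrees 0 and d. -/
theorem sum_opF_logTower {θ : ℝ} {d : ℕ} (hd : 0 < d) {w : Fin d → ℂ}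
    (hw : ∀ i, w i ∈ halfPlane θ) {q : ℕ} (hq : q ≤ d) {M : ℕ} (hM : 0 < M) :
    ∑ m ∈ Finset.range (d - q + 1), toddCoeff w m *
      opF w (fun y => logTower θ d (q + m) (M * y)) =
      toddCoeff w (d - q) * (-1) ^ d * (Real.log M : ℂ) +
      (if q = 0 then (M : ℂ) ^ d * (harm d - (Real.log M : ℂ)) else 0) -
      ∑ m ∈ Finset.range (d - q + 1), coeffS w m / ((m ! : ℂ) * ((d - q - m)! : ℂ)) *
        opF w (fun x => x ^ (d - q - m) * branchLog θ x) * (M : ℂ) ^ (d - q - m) := by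
  have h : ∀ m ∈ Finset.range (d - q + 1), toddCoeff w m *
      opF w (fun y => logTower θ d (q + m) (M * y)) =
      (toddCoeff w m * (M : ℂ) ^ (d - q - m) * (harm (d - q - m) - (Real.log M : ℂ))) *
        (if d - q - m = 0 then -(-1 : ℂ) ^ d else
        if d - q - m = d then diffCoeff w d else 0) -
      coeffS w m / ((m ! : ℂ) * ((d - q - m)! : ℂ)) *
        opF w (fun x => x ^ (d - q - m) * branchLog θ x) * (M : ℂ) ^ (d - q - m) := by
    intro m hm
    rw [Finset.mem_range] at hm
    have h1 : opF w (fun y => logTower θ d (q + m) (M * y)) = opF w fun y =>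
        ((M : ℂ) ^ (d - q - m) * (harm (d - q - m) - (Real.log M : ℂ))) *
          (y ^ (d - q - m) / ((d - q - m)! : ℂ)) -
        (M : ℂ) ^ (d - q - m) / ((d - q - m)! : ℂ) * (y ^ (d - q - m) * branchLog θ y) := by
      refine opF_congr hw fun y hy => ?_
      have h2 := branchLog_real_mul (θ := θ) (show (0 : ℝ) < M by exact_mod_cast hM)
        (ne_zero_of_mem_halfPlane hy)
      rw [Complex.ofReal_natCast] at h2
      rw [logTower, if_pos (by omega), ← Nat.sub_sub, h2, mul_pow]
      ring
    rw [h1, opF_sub, opF_const_mul, opF_const_mul, opF_pow hd w (by omega), coeffS_div]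
    ring
  rw [Finset.sum_congr rfl h, Finset.sum_sub_distrib, sum_range_ite_boundary hd hq
    (fun m => toddCoeff w m * (M : ℂ) ^ (d - q - m) * (harm (d - q - m) - (Real.log M : ℂ)))]
  simp only [Nat.sub_self, harm_zero, pow_zero, Nat.sub_zero]
  split_ifs with h0
  · subst h0
    have := toddCoeff_zero_mul_diffCoeff hd w fun i => ne_zero_of_mem_halfPlane (hw i)
    simp only [Nat.sub_zero]
    linear_combination ((M : ℂ) ^ d * (harm d - (Real.log M : ℂ))) * this
  · ring

theorem hasSum_logTower {θ : ℝ} {d : ℕ} (hd : 0 < d) {w : Fin d → ℂ}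
    (hw : ∀ i, w i ∈ halfPlane θ) {q : ℕ} (hq : q ≤ d) :
    HasSum (fun n : {n : Fin d → ℕ // n ≠ 0} =>
      logTower θ d (d + q) (dotW n.1 w) - (if q = 0 then harm d else 0) +
      ∑ m ∈ Finset.range (d - q + 1), coeffS w m / ((m ! : ℂ) * ((d - q - m)! : ℂ)) *
        opG w (fun y => (dotW n.1 w + y) ^ (d - q - m) * branchLog θ (dotW n.1 w + y)))
      (regSum w (d - q) (fun k => logTower θ d (q + k)) 0 + (if q = 0 then harm d else 0) -
        ∑ m ∈ Finset.range (d - q + 1), coeffS w m / ((m ! : ℂ) * ((d - q - m)! : ℂ)) *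
          opF w (fun x => x ^ (d - q - m) * branchLog θ x)) := by
  have h := (summable_regTerm_logTower hd hw (zero_mem_coneDomain hw)
    (show d ≤ q + (d - q) by omega)).hasSum
  simp only [zero_add, regTerm_logTower hd hw hq] at h
  convert h using 1
  -- The finite sum inside `regSum` is the boundary sum at scale M = 1.
  have h1 := sum_opF_logTower hd hw hq one_pos
  simp only [Nat.cast_one, one_mul, Real.log_one, Complex.ofReal_zero, mul_zero, zero_add,
    one_pow, sub_zero, mul_one] at h1
  simp only [regSum, zero_add, regTerm_logTower hd hw hq, h1]
  ring

theorem tendsto_logTower {θ : ℝ} {d : ℕ} (hd : 0 < d) {w : Fin d → ℂ}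
    (hw : ∀ i, w i ∈ halfPlane θ) {q : ℕ} (hq : q ≤ d) :
    Tendsto (fun M : ℕ => ∑ n ∈ puncturedCube d M, logTower θ d (d + q) (dotW n w) -
      (toddCoeff w (d - q) * (-1) ^ d * (Real.log M : ℂ) +
      (if q = 0 then (M : ℂ) ^ d * (harm d - (Real.log M : ℂ)) else 0) -
      ∑ m ∈ Finset.range (d - q + 1), coeffS w m / ((m ! : ℂ) * ((d - q - m)! : ℂ)) *
        opF w (fun x => x ^ (d - q - m) * branchLog θ x) * (M : ℂ) ^ (d - q - m))) atTop
      (𝓝 (regSum w (d - q) (fun k => logTower θ d (q + k)) 0)) := by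
  refine (tendsto_regSum w (d - q) _ 0 (summable_regTerm_logTower hd hw (zero_mem_coneDomain hw)
    (show d ≤ q + (d - q) by omega))).congr' ?_
  filter_upwards [eventually_gt_atTop 0] with M hM
  simp only [zero_add, sum_opF_logTower hd hw hq hM, add_comm q d]

/-! ### Residues and finite parts at 1, …, d -/

/-- The residue of the homogeneous Barnes zeta function at `q`. -/
noncomputable def homResidue {d : ℕ} (w : Fin d → ℂ) (q : ℕ) : ℂ :=
  (-1) ^ q / ((q - 1)! : ℂ) * (-1) ^ d * toddCoeff w (d - q)

theorem tendsto_zetaTower_self (θ : ℝ) {d q : ℕ} (hq : 0 < q) {z : ℂ} (hz : z ≠ 0) :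
    Tendsto (fun α => zetaTower θ d α d z) (𝓝[≠] (q : ℂ))
      (𝓝 ((-1) ^ q / ((q - 1)! : ℂ) * logTower θ d (d + q) z)) := by
  have h1 : Tendsto (fun α => branchPow θ z (-α)) (𝓝[≠] (q : ℂ)) (𝓝 (branchPow θ z (-q))) := by
    have : Continuous fun α => branchPow θ z (-α) := by unfold branchPow; fun_prop
    exact (this.tendsto _).mono_left nhdsWithin_le_nhds
  have h2 : (-1 : ℂ) ^ q / ((q - 1)! : ℂ) * logTower θ d (d + q) z = branchPow θ z (-q) := by
    have h3 : ((q - 1)! : ℂ) ≠ 0 := by exact_mod_cast Nat.factorial_ne_zero _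
    have h4 : (-1 : ℂ) ^ q * (-1) ^ q = 1 := by rw [← mul_pow]; norm_num
    rw [logTower_add θ d hq, branchPow_neg, branchPow_natCast hz]
    field_simp
    linear_combination h4
  rw [h2]
  refine h1.congr' ?_
  filter_upwards [eventually_mem_regularSet d q] with α hα
  rw [zetaTower_self θ hα]

theorem tendsto_zetaTower_sub' (θ : ℝ) {d q k : ℕ} (hq : 0 < q) (hqd : q ≤ d) (hk : k ≤ d - q)
    {z : ℂ} (hz : z ≠ 0) :
    Tendsto (fun α => zetaTower θ d α k z - (-1) ^ q / ((q - 1)! : ℂ) / (α - q) *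
        (z ^ (d - q - k) / ((d - q - k)! : ℂ))) (𝓝[≠] (q : ℂ))
      (𝓝 ((-1) ^ q / ((q - 1)! : ℂ) * (logTower θ d (q + k) z -
        harm (q - 1) * (z ^ (d - q - k) / ((d - q - k)! : ℂ))))) := by
  obtain ⟨p, rfl⟩ : ∃ p, q = p + 1 := ⟨q - 1, by omega⟩
  exact tendsto_zetaTower_sub θ (by omega) hz

/-- As q > 0, the polynomial has degree below d and is killed by G. Hence singular parts can be
subtracted inside each term of the series without changing it. -/
theorem opG_eq_opG_sub_pow {d : ℕ} (w : Fin d → ℂ) {q m : ℕ} (hq : 0 < q) (hqd : q ≤ d)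
    (c : ℂ) (f : ℂ → ℂ) (x : ℂ) :
    opG w (fun y => f (x + y)) = opG w (fun y => f (x + y) -
      c * ((x + y) ^ (d - q - m) / ((d - q - m)! : ℂ))) := by
  rw [opG_sub, opG_const_mul, opG_add_pow w x (by omega), if_neg (by omega), mul_zero, sub_zero]

theorem tendsto_regTerm_zetaTower {θ : ℝ} {d : ℕ} {w : Fin d → ℂ}
    (hw : ∀ i, w i ∈ halfPlane θ) {q : ℕ} (hq : 0 < q) (hqd : q ≤ d) {x : ℂ}
    (hx : x ∈ halfPlane θ) :
    Tendsto (fun α => regTerm w (d - q) (zetaTower θ d α) x) (𝓝[≠] (q : ℂ))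
      (𝓝 ((-1) ^ q / ((q - 1)! : ℂ) *
        regTerm w (d - q) (fun k => logTower θ d (q + k)) x)) := by
  unfold regTerm
  rw [mul_sub, Finset.mul_sum]
  beta_reduce
  rw [add_comm q d]
  refine (tendsto_zetaTower_self θ hq (ne_zero_of_mem_halfPlane hx)).sub
    (tendsto_finsetSum _ fun m hm => ?_)
  rw [Finset.mem_range, Nat.lt_succ_iff] at hm
  rw [mul_left_comm]
  refine Tendsto.const_mul _ ?_
  rw [opG_eq_opG_sub_pow w hq hqd (m := m) (harm (q - 1)) (logTower θ d (q + m)), ← opG_const_mul]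
  simp only [fun α => opG_eq_opG_sub_pow w hq hqd (m := m)
    ((-1) ^ q / ((q - 1)! : ℂ) / (α - q)) (zetaTower θ d α m) x]
  simp only [opG_eq_sum]
  exact tendsto_finsetSum _ fun S _ => (tendsto_zetaTower_sub' θ hq hqd hm
    (ne_zero_of_mem_halfPlane (add_sum_mem_halfPlane hw hx S))).const_mul _

/-- The boundary sum does feel the singular parts, but only through the constant polynomial at m = d
− q; this produces the residue. -/
theorem sum_toddCoeff_opF_pow {d : ℕ} (hd : 0 < d) (w : Fin d → ℂ) {q : ℕ} (hq : 0 < q)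
    (hqd : q ≤ d) (c : ℂ) :
    ∑ m ∈ Finset.range (d - q + 1), toddCoeff w m *
      opF w (fun y => c * (y ^ (d - q - m) / ((d - q - m)! : ℂ))) =
      -(c * (-1) ^ d * toddCoeff w (d - q)) := by
  have h : ∀ m, opF w (fun y => c * (y ^ (d - q - m) / ((d - q - m)! : ℂ))) = c *
      (if d - q - m = 0 then -(-1 : ℂ) ^ d else if d - q - m = d then diffCoeff w d else 0) :=
    fun m => by rw [opF_const_mul, opF_pow hd w (by omega)]
  simp only [h, ← mul_assoc]
  rw [sum_range_ite_boundary hd hqd (fun m => toddCoeff w m * c), if_neg hq.ne']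
  ring

/-- The series converges by dominated convergence to its logarithmic counterpart, with no pole. The
pole and the multiple of H_{q−1} both come from the finite boundary sum. -/
theorem tendsto_homBarnesZeta_sub {θ : ℝ} {d : ℕ} (hd : 0 < d) {w : Fin d → ℂ}
    (hw : ∀ i, w i ∈ halfPlane θ) {q : ℕ} (hq : 0 < q) (hqd : q ≤ d) :
    Tendsto (fun α => homBarnesZeta θ w α - homResidue w q / (α - q)) (𝓝[≠] (q : ℂ))
      (𝓝 ((-1) ^ q / ((q - 1)! : ℂ) * regSum w (d - q) (fun k => logTower θ d (q + k)) 0 -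
        harm (q - 1) * homResidue w q)) := by
  have h0 := zero_mem_coneDomain hw
  -- N = d − q is the least admissible order at α = q, and for it every boundary polynomial has
  -- degree d − q − m ≥ 0.
  have hN : (d : ℝ) < (q : ℂ).re + (d - q : ℕ) + 1 := by
    rw [Complex.natCast_re]
    exact_mod_cast (show d < q + (d - q) + 1 by omega)
  have h1 : Tendsto (fun α => ∑' n : {n : Fin d → ℕ // n ≠ 0},
      regTerm w (d - q) (zetaTower θ d α) (0 + dotW n.1 w)) (𝓝[≠] (q : ℂ))
      (𝓝 (∑' n : {n : Fin d → ℕ // n ≠ 0}, (-1) ^ q / ((q - 1)! : ℂ) *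
        regTerm w (d - q) (fun k => logTower θ d (q + k)) (0 + dotW n.1 w))) := by
    obtain ⟨v, hv, hb⟩ := exists_summable_regTerm_zetaTower hd hw h0 hN
    refine tendsto_tsum_of_dominated_convergence hv (fun n =>
      tendsto_regTerm_zetaTower hw hq hqd (add_dotW_mem_halfPlane hw h0 n.2)) ?_
    filter_upwards [hb.filter_mono nhdsWithin_le_nhds, eventually_mem_regularSet d q]
      with α h h' n
    exact h h' n
  rw [tsum_mul_left] at h1
  have h2 : Tendsto (fun α => ∑ m ∈ Finset.range (d - q + 1), toddCoeff w m *
      opF w (fun y => zetaTower θ d α m y - (-1) ^ q / ((q - 1)! : ℂ) / (α - q) *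
        (y ^ (d - q - m) / ((d - q - m)! : ℂ)))) (𝓝[≠] (q : ℂ))
      (𝓝 (∑ m ∈ Finset.range (d - q + 1), toddCoeff w m *
        opF w (fun y => (-1) ^ q / ((q - 1)! : ℂ) * (logTower θ d (q + m) y -
        harm (q - 1) * (y ^ (d - q - m) / ((d - q - m)! : ℂ)))))) := by
    refine tendsto_finsetSum _ fun m hm => Tendsto.const_mul _ ?_
    rw [Finset.mem_range, Nat.lt_succ_iff] at hm
    unfold opF
    exact tendsto_finsetSum _ fun S hS => (tendsto_zetaTower_sub' θ hq hqd hm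
      (ne_zero_of_mem_halfPlane (sum_mem_halfPlane hw (Finset.mem_filter.1 hS).2))).const_mul _
  refine ((h2.neg.add h1).congr' ?_).trans_eq ?_
  · filter_upwards [(zetaCont_eventuallyEq hd hw h0 hN).filter_mono nhdsWithin_le_nhds,
      eventually_mem_regularSet d q] with α h h'
    rw [homBarnesZeta_eq hd hw h', h h', regSum]
    simp only [opF_sub, mul_sub, Finset.sum_sub_distrib, sum_toddCoeff_opF_pow hd w hq hqd,
      zero_add, homResidue]
    ring
  · congr 1
    simp only [opF_const_mul w ((-1) ^ q / ((q - 1)! : ℂ)), mul_left_comm (toddCoeff w _),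
      ← Finset.mul_sum]
    simp only [opF_sub, mul_sub, Finset.sum_sub_distrib, sum_toddCoeff_opF_pow hd w hq hqd,
      zero_add, homResidue, regSum]
    ring

theorem residue_homBarnesZeta {θ : ℝ} {d : ℕ} (hd : 0 < d) {w : Fin d → ℂ}
    (hw : ∀ i, w i ∈ halfPlane θ) {q : ℕ} (hq : 0 < q) (hqd : q ≤ d) :
    residue (homBarnesZeta θ w) q = homResidue w q := by
  have h1 : Tendsto (fun α : ℂ => α - q) (𝓝[≠] (q : ℂ)) (𝓝 0) := by
    have : Tendsto (fun α : ℂ => α - q) (𝓝 (q : ℂ)) (𝓝 (q - q)) :=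
      (continuous_id.sub continuous_const).tendsto _
    rw [sub_self] at this
    exact this.mono_left nhdsWithin_le_nhds
  have h2 := (h1.mul (tendsto_homBarnesZeta_sub hd hw hq hqd)).add_const (homResidue w q)
  rw [zero_mul, zero_add] at h2
  refine Tendsto.limUnder_eq (h2.congr' ?_)
  filter_upwards [self_mem_nhdsWithin] with α hα
  have : α - q ≠ 0 := sub_ne_zero.2 hα
  field_simp
  ring

theorem finitePart_homBarnesZeta {θ : ℝ} {d : ℕ} (hd : 0 < d) {w : Fin d → ℂ}
    (hw : ∀ i, w i ∈ halfPlane θ) {q : ℕ} (hq : 0 < q) (hqd : q ≤ d) :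
    finitePart (homBarnesZeta θ w) q =
      (-1) ^ q / ((q - 1)! : ℂ) * regSum w (d - q) (fun k => logTower θ d (q + k)) 0 -
        harm (q - 1) * homResidue w q := by
  rw [finitePart, residue_homBarnesZeta hd hw hq hqd]
  exact (tendsto_homBarnesZeta_sub hd hw hq hqd).limUnder_eq

theorem homResidue_eq {d : ℕ} (w : Fin d → ℂ) (q : ℕ) :
    coeffS w (d - q) * (-1 : ℂ) ^ (d + q + 1) / (((q - 1)! : ℂ) * ((d - q)! : ℂ)) =
      -homResidue w q := by
  rw [homResidue, toddCoeff, pow_succ, pow_add]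
  ring

theorem one_div_pow_eq (θ : ℝ) (d : ℕ) {q : ℕ} (hq : 0 < q) (z : ℂ) :
    1 / z ^ q = (-1) ^ q / ((q - 1)! : ℂ) * logTower θ d (d + q) z := by
  have h3 : ((q - 1)! : ℂ) ≠ 0 := by exact_mod_cast Nat.factorial_ne_zero _
  have h4 : (-1 : ℂ) ^ q * (-1) ^ q = 1 := by rw [← mul_pow]; norm_num
  rw [logTower_add θ d hq]
  field_simp
  linear_combination (-1 / z ^ q) * h4

end BarnesH

theorem mainTheorem9 (d : ℕ) (hd : 0 < d) (θ : ℝ) (w : Fin d → ℂ)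
    (hw : ∀ i, w i ∈ BarnesH.halfPlane θ) :
    -- the continuations of both zeta functions exist, and `log Γ_B` is analytic in `a`
    BarnesH.IsHomBarnesZeta θ w (BarnesH.homBarnesZeta θ w) ∧
    (∀ a ∈ BarnesH.halfPlane θ, BarnesH.IsBarnesZeta θ w a (BarnesH.barnesZeta θ w a)) ∧
    DifferentiableOn ℂ (BarnesH.logGammaB θ w) (BarnesH.halfPlane θ) ∧
    (∀ q ∈ Finset.Icc 1 d,
      -- at `q` there is at most a simple pole
      Tendsto (fun α => BarnesH.homBarnesZeta θ w α -
          BarnesH.residue (BarnesH.homBarnesZeta θ w) q / (α - q)) (𝓝[≠] (q : ℂ))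
        (𝓝 (BarnesH.finitePart (BarnesH.homBarnesZeta θ w) q)) ∧
      -- finite part, series form
      HasSum (fun n : {n : Fin d → ℕ // n ≠ 0} =>
          1 / BarnesH.dotW n.1 w ^ q +
          (-1 : ℂ) ^ q / ((q - 1)! : ℂ) * ∑ m ∈ Finset.range (d - q + 1),
            BarnesH.coeffS w m / ((m ! : ℂ) * ((d - q - m)! : ℂ)) *
              BarnesH.opG w (fun x => (BarnesH.dotW n.1 w + x) ^ (d - q - m) *
                BarnesH.branchLog θ (BarnesH.dotW n.1 w + x)))
        (BarnesH.finitePart (BarnesH.homBarnesZeta θ w) q -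
          ((-1 : ℂ) ^ q / ((q - 1)! : ℂ) * ∑ m ∈ Finset.range (d - q + 1),
              BarnesH.coeffS w m / ((m ! : ℂ) * ((d - q - m)! : ℂ)) *
                BarnesH.opF w (fun x => x ^ (d - q - m) * BarnesH.branchLog θ x) +
            BarnesH.coeffS w (d - q) * (-1 : ℂ) ^ (d + q + 1) /
              (((q - 1)! : ℂ) * ((d - q)! : ℂ)) * BarnesH.harm (q - 1))) ∧
      -- finite part, limit form
      Tendsto (fun M : ℕ =>
          ((-1 : ℂ) ^ q / ((q - 1)! : ℂ) * ∑ m ∈ Finset.range (d - q + 1),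
              BarnesH.coeffS w m / ((m ! : ℂ) * ((d - q - m)! : ℂ)) *
                BarnesH.opF w (fun x => x ^ (d - q - m) * BarnesH.branchLog θ x) *
                (M : ℂ) ^ (d - q - m) +
            BarnesH.coeffS w (d - q) * (-1 : ℂ) ^ (d + q + 1) /
              (((q - 1)! : ℂ) * ((d - q)! : ℂ)) * (Real.log M : ℂ) +
            ∑ n ∈ BarnesH.puncturedCube d M, 1 / BarnesH.dotW n w ^ q) +
          BarnesH.coeffS w (d - q) * (-1 : ℂ) ^ (d + q + 1) /
            (((q - 1)! : ℂ) * ((d - q)! : ℂ)) * BarnesH.harm (q - 1))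
        atTop (𝓝 (BarnesH.finitePart (BarnesH.homBarnesZeta θ w) q)) ∧
      -- relation with the gamma modular forms
      Tendsto (BarnesH.gammaModularAux θ w q) (𝓝[BarnesH.halfPlane θ] 0)
        (𝓝 (BarnesH.gammaModular θ w q)) ∧
      BarnesH.finitePart (BarnesH.homBarnesZeta θ w) q =
        (-1 : ℂ) ^ (q - 1) / ((q - 1)! : ℂ) * BarnesH.gammaModular θ w q -
          BarnesH.harm (q - 1) * BarnesH.residue (BarnesH.homBarnesZeta θ w) q) ∧
    -- derivative at `0`, series form
    HasSum (fun n : {n : Fin d → ℕ // n ≠ 0} =>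
        -BarnesH.branchLog θ (BarnesH.dotW n.1 w) - BarnesH.harm d +
        ∑ m ∈ Finset.range (d + 1), BarnesH.coeffS w m / ((m ! : ℂ) * ((d - m)! : ℂ)) *
          BarnesH.opG w (fun x => (BarnesH.dotW n.1 w + x) ^ (d - m) *
            BarnesH.branchLog θ (BarnesH.dotW n.1 w + x)))
      (deriv (BarnesH.homBarnesZeta θ w) 0 -
        (∑ m ∈ Finset.range (d + 1), BarnesH.coeffS w m / ((m ! : ℂ) * ((d - m)! : ℂ)) *
          BarnesH.opF w (fun x => x ^ (d - m) * BarnesH.branchLog θ x) - BarnesH.harm d)) ∧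
    -- derivative at `0`, limit form
    Tendsto (fun M : ℕ =>
        (M : ℂ) ^ d * ((Real.log M : ℂ) - BarnesH.harm d) +
        ∑ m ∈ Finset.range (d + 1), BarnesH.coeffS w m / ((m ! : ℂ) * ((d - m)! : ℂ)) *
          BarnesH.opF w (fun x => x ^ (d - m) * BarnesH.branchLog θ x) * (M : ℂ) ^ (d - m) +
        (-1 : ℂ) ^ (d - 1) * (BarnesH.coeffS w d / (d ! : ℂ)) * (Real.log M : ℂ) -
        ∑ n ∈ BarnesH.puncturedCube d M, BarnesH.branchLog θ (BarnesH.dotW n w))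
      atTop (𝓝 (deriv (BarnesH.homBarnesZeta θ w) 0)) ∧
    -- relation with `ρ_B`
    Tendsto (fun a => deriv (BarnesH.barnesZeta θ w a) 0 + BarnesH.branchLog θ a)
      (𝓝[BarnesH.halfPlane θ] 0) (𝓝 (-BarnesH.logRho θ w)) ∧
    deriv (BarnesH.homBarnesZeta θ w) 0 = -BarnesH.logRho θ w := by
  have := BarnesH.neBot_nhdsWithin_halfPlane (hw ⟨0, hd⟩)
  have hreg0 := BarnesH.neg_logRho_eq hd hw
  refine ⟨BarnesH.isHomBarnesZeta_homBarnesZeta hd hw,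
    fun a ha => BarnesH.isBarnesZeta_barnesZeta hd hw ha,
    BarnesH.differentiableOn_logGammaB hd hw, ?_, ?_, ?_, ?_, ?_⟩
  · intro q hqm
    obtain ⟨hq, hqd⟩ := Finset.mem_Icc.1 hqm
    have hres := BarnesH.residue_homBarnesZeta hd hw hq hqd
    have hfin := BarnesH.finitePart_homBarnesZeta hd hw hq hqd
    refine ⟨?_, ?_, ?_, ?_, ?_⟩
    · rw [hres, hfin]
      exact BarnesH.tendsto_homBarnesZeta_sub hd hw hq hqd
    · have h := (BarnesH.hasSum_logTower hd hw hqd).mul_left ((-1 : ℂ) ^ q / ((q - 1)! : ℂ))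
      simp only [if_neg (Nat.pos_iff_ne_zero.1 hq), sub_zero, add_zero] at h
      simp only [BarnesH.one_div_pow_eq θ d hq, ← mul_add, BarnesH.homResidue_eq, hfin]
      refine Eq.subst (motive := HasSum _) ?_ h
      ring
    · have h := ((BarnesH.tendsto_logTower hd hw hqd).const_mul
        ((-1 : ℂ) ^ q / ((q - 1)! : ℂ))).sub_const
          (BarnesH.harm (q - 1) * BarnesH.homResidue w q)
      rw [← hfin] at h
      refine h.congr fun M => ?_
      simp only [if_neg (Nat.pos_iff_ne_zero.1 hq), BarnesH.one_div_pow_eq θ d hq,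
        BarnesH.homResidue_eq, ← Finset.mul_sum]
      rw [BarnesH.homResidue]
      ring
    · rw [BarnesH.gammaModular, (BarnesH.tendsto_gammaModularAux hd hw hq).limUnder_eq]
      exact BarnesH.tendsto_gammaModularAux hd hw hq
    · rw [hfin, hres, BarnesH.gammaModular_eq hd hw hq]
      obtain ⟨p, rfl⟩ : ∃ p, q = p + 1 := ⟨q - 1, by omega⟩
      rw [Nat.add_sub_cancel, pow_succ]
      ring
  · have h := BarnesH.hasSum_logTower hd hw (Nat.zero_le d)
    simp only [if_true, Nat.sub_zero, add_zero, zero_add, BarnesH.logTower_self] at h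
    rw [BarnesH.deriv_homBarnesZeta_zero hd hw]
    convert h using 1
    ring
  · have h := BarnesH.tendsto_logTower hd hw (Nat.zero_le d)
    simp only [if_true, Nat.sub_zero, add_zero, zero_add, BarnesH.logTower_self] at h
    rw [BarnesH.deriv_homBarnesZeta_zero hd hw]
    refine h.congr fun M => ?_
    obtain ⟨e, rfl⟩ : ∃ e, d = e + 1 := ⟨d - 1, by omega⟩
    rw [Finset.sum_neg_distrib, BarnesH.toddCoeff, Nat.add_sub_cancel, pow_succ (-1 : ℂ) e]
    ring
  · rw [hreg0]
    exact BarnesH.tendsto_deriv_barnesZeta_add_log hd hw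
  · rw [hreg0, BarnesH.deriv_homBarnesZeta_zero hd hw]
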